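/- Let $R$ be a commutative ring (for instance $\mathbb{C}$, or $\mathbb{C}[q^{\pm1},v_1,\dots,v_m]$ with $q,v_1,\dots,v_m$ indeterminates), let $m,n\ge 0$ be integers, let $q\in R$ be invertible and let $v_1,\dots,v_m\in R$. The cyclotomic Hecke algebra $H(m,1,n)$ is the associative unital $R$-algebra with generators $\tau,\sigma_1,\dots,\sigma_{n-1}$ (no generators if $n=0$, so that $H(m,1,0)=R$) and relations \begin{align*} &\sigma_i\sigma_{i+1}\sigma_i=\sigma_{i+1}\sigma_i\sigma_{i+1}\ (1\le i\le n-2),\qquad \sigma_i\sigma_j=\sigma_j\sigma_i\ (|i-j|>1),\\ &\tau\sigma_1\tau\sigma_1=\sigma_1\tau\sigma_1\tau,\qquad \tau\sigma_i=\sigma_i\tau\ (i>1),\\ &\sigma_i^2=(q-q^{-1})\sigma_i+1\ (1\le i\le n-1),\qquad (\tau-v_1)\cdots(\tau-v_m)=0 . \end{align*} In particular every $\sigma_i$ is invertible. If all $v_a$ are invertible then so is $\tau$, and $H(m,1,n)$ is the quotient of the group algebra over $R$ of the braid group of type $B$ by the last two families of relations. For $k=1,\dots,n$ let $$R_k=\{\sigma_j^{-1}\sigma_{j-1}^{-1}\cdots\sigma_1^{-1}\,\tau^{\alpha}\,\sigma_1\sigma_2\cdots\sigma_{k-1}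 : 0\le j\le k-1,\ 0\le\alpha\le m-1\},$$ regarded as a family indexed by the pairs $(j,\alpha)$. Then every element of $H(m,1,n)$ can be written uniquely as a linear combination, with coefficients in $R$, of the products $u_nu_{n-1}\cdots u_1$ with $u_k\in R_k$ for $k=1,\dots,n$; that is, these products, indexed by the choices of a pair $(j_k,\alpha_k)$ for each $k$, form a basis of the $R$-module $H(m,1,n)$. -/

import Mathlib

namespace CyclotomicHecke

/-- The generators of `H(m,1,n)`: `τ` (present as soon as `1 ≤ n`) and `σ_1, …, σ_{n-1}`. -/
inductive Gen (n : ℕ) : Type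
  | tau (h : 1 ≤ n) : Gen n
  | sigma (i : ℕ) (h₁ : 1 ≤ i) (h₂ : i < n) : Gen n

section Presentation

variable {R : Type*} [CommRing R] {m : ℕ}

/-- The generator `τ` in the free algebra. -/
def freeTau (R : Type*) [CommRing R] {n : ℕ} (h : 1 ≤ n) : FreeAlgebra R (Gen n) :=
  FreeAlgebra.ι R (Gen.tau h)

/-- The generator `σ_i` in the free algebra. -/
def freeSigma (R : Type*) [CommRing R] {n : ℕ} (i : ℕ) (h₁ : 1 ≤ i) (h₂ : i < n) :
    FreeAlgebra R (Gen n) :=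
  FreeAlgebra.ι R (Gen.sigma i h₁ h₂)

/-- The defining relations of `H(m,1,n)` with parameters `q, v_1, …, v_m`. -/
inductive Rel (q : Rˣ) (v : Fin m → R) (n : ℕ) :
    FreeAlgebra R (Gen n) → FreeAlgebra R (Gen n) → Prop
  | braid (i : ℕ) (h₁ : 1 ≤ i) (h₂ : i + 1 < n) :
      Rel q v n
        (freeSigma R i h₁ (by omega) * freeSigma R (i + 1) (by omega) h₂ *
          freeSigma R i h₁ (by omega))
        (freeSigma R (i + 1) (by omega) h₂ * freeSigma R i h₁ (by omega) *
          freeSigma R (i + 1) (by omega) h₂)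
  | comm (i j : ℕ) (hi₁ : 1 ≤ i) (hi₂ : i < n) (hj₁ : 1 ≤ j) (hj₂ : j < n)
      (hij : 1 < |(i : ℤ) - (j : ℤ)|) :
      Rel q v n
        (freeSigma R i hi₁ hi₂ * freeSigma R j hj₁ hj₂)
        (freeSigma R j hj₁ hj₂ * freeSigma R i hi₁ hi₂)
  | tau_braid (h : 1 < n) :
      Rel q v n
        (freeTau R h.le * freeSigma R 1 le_rfl h * freeTau R h.le * freeSigma R 1 le_rfl h)
        (freeSigma R 1 le_rfl h * freeTau R h.le * freeSigma R 1 le_rfl h * freeTau R h.le)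
  | tau_comm (i : ℕ) (h₁ : 1 < i) (h₂ : i < n) :
      Rel q v n
        (freeTau R (by omega) * freeSigma R i h₁.le h₂)
        (freeSigma R i h₁.le h₂ * freeTau R (by omega))
  | quadratic (i : ℕ) (h₁ : 1 ≤ i) (h₂ : i < n) :
      Rel q v n
        (freeSigma R i h₁ h₂ ^ 2)
        (((q : R) - ((q⁻¹ : Rˣ) : R)) • freeSigma R i h₁ h₂ + 1)
  | cyclotomic (h : 1 ≤ n) :
      Rel q v n
        (List.ofFn fun a : Fin m => freeTau R h - algebraMap R _ (v a)).prod
        0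

end Presentation

end CyclotomicHecke

/-- The cyclotomic Hecke algebra `H(m,1,n)` over the commutative ring `R`, with parameters an
invertible `q` and `v_1, …, v_m`, given by generators and relations. The generators `σ_i` are
invertible by the quadratic relation; `τ` is invertible whenever all `v_a` are, and then the algebra
is the quotient of the group algebra of the type B braid group, see
`CyclotomicHecke.exists_equiv_groupQuotient`. -/
abbrev CyclotomicHecke {R : Type*} [CommRing R] {m : ℕ} (q : Rˣ) (v : Fin m → R) (n : ℕ) : Type _ :=
  RingQuot (CyclotomicHecke.Rel q v n)

namespace CyclotomicHecke

section Elements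

variable {R : Type*} [CommRing R] {m : ℕ} (q : Rˣ) (v : Fin m → R) {n : ℕ}

/-- The element `τ` of `H(m,1,n)`. -/
def tau (h : 1 ≤ n) : CyclotomicHecke q v n :=
  RingQuot.mkAlgHom R (Rel q v n) (freeTau R h)

/-- The element `σ_i` of `H(m,1,n)`, not yet as a unit. -/
def sigmaElt (i : ℕ) (h₁ : 1 ≤ i) (h₂ : i < n) : CyclotomicHecke q v n :=
  RingQuot.mkAlgHom R (Rel q v n) (freeSigma R i h₁ h₂)

theorem sigmaElt_sq (i : ℕ) (h₁ : 1 ≤ i) (h₂ : i < n) :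
    sigmaElt q v i h₁ h₂ ^ 2 =
      ((q : R) - ((q⁻¹ : Rˣ) : R)) • sigmaElt q v i h₁ h₂ + 1 := by
  have h := RingQuot.mkAlgHom_rel R (Rel.quadratic (q := q) (v := v) i h₁ h₂)
  simp only [map_pow, map_add, map_smul, map_one] at h
  exact h

/-- The invertible element `σ_i` of `H(m,1,n)`, with inverse `σ_i - (q - q⁻¹)`. -/
def sigma (i : ℕ) (h₁ : 1 ≤ i) (h₂ : i < n) : (CyclotomicHecke q v n)ˣ where
  val := sigmaElt q v i h₁ h₂
  inv := sigmaElt q v i h₁ h₂ - ((q : R) - ((q⁻¹ : Rˣ) : R)) • 1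
  val_inv := by
    rw [mul_sub, mul_smul_comm, mul_one, ← pow_two, sigmaElt_sq, add_sub_cancel_left]
  inv_val := by
    rw [sub_mul, smul_mul_assoc, one_mul, ← pow_two, sigmaElt_sq, add_sub_cancel_left]

/-- `σ_j⁻¹ σ_{j-1}⁻¹ ⋯ σ_1⁻¹`, for `j ≤ n - 1`. -/
def descInv : (j : ℕ) → j < n → CyclotomicHecke q v n
  | 0, _ => 1
  | j + 1, h =>
      (((sigma q v (j + 1) (Nat.succ_pos j) h)⁻¹ : (CyclotomicHecke q v n)ˣ) :
        CyclotomicHecke q v n) * descInv j (by omega)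

/-- `σ_1 σ_2 ⋯ σ_j`, for `j ≤ n - 1`. -/
def asc : (j : ℕ) → j < n → CyclotomicHecke q v n
  | 0, _ => 1
  | j + 1, h =>
      asc j (by omega) * (sigma q v (j + 1) (Nat.succ_pos j) h : CyclotomicHecke q v n)

/-- The element `σ_j⁻¹ ⋯ σ_1⁻¹ τ^α σ_1 σ_2 ⋯ σ_{k-1}` of the set `R_k`, where
`1 ≤ k ≤ n`, `0 ≤ j ≤ k - 1` and `0 ≤ α ≤ m - 1`. -/
def factor (k : ℕ) (h₁ : 1 ≤ k) (h₂ : k ≤ n) (j : Fin k) (α : Fin m) : CyclotomicHecke q v n :=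
  descInv q v j.val (by omega) * tau q v (by omega) ^ α.val * asc q v (k - 1) (by omega)

/-- A choice of an element of `R_k` (that is, of the pair `(j, α)`) for every `k = 1, …, n`.
The component at `i : Fin n` belongs to `k = i + 1`. -/
abbrev Choice (m n : ℕ) : Type := (i : Fin n) → Fin (i.val + 1) × Fin m

/-- The product `u_n u_{n-1} ⋯ u_1`, with the `u_k ∈ R_k` given by a choice of pairs. -/
def normalWord (c : Choice m n) : CyclotomicHecke q v n :=
  (List.ofFn fun i : Fin n =>
    factor q v (i.val + 1) (Nat.succ_pos _) i.isLt (c i).1 (c i).2).reverse.prod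

end Elements

/-! Comparison with the construction as a quotient of the group algebra of the type B braid
group. -/

section GroupQuotient

/-- The relators of the braid group of type B. -/
inductive BraidRelator (n : ℕ) : FreeGroup (Gen n) → Prop
  | braid (i : ℕ) (h₁ : 1 ≤ i) (h₂ : i + 1 < n) (a b : FreeGroup (Gen n))
      (ha : a = FreeGroup.of (Gen.sigma i h₁ (by omega)))
      (hb : b = FreeGroup.of (Gen.sigma (i + 1) (by omega) h₂)) :
      BraidRelator n (a * b * a * (b * a * b)⁻¹)
  | comm (i j : ℕ) (hi₁ : 1 ≤ i) (hi₂ : i < n) (hj₁ : 1 ≤ j) (hj₂ : j < n)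
      (hij : 1 < |(i : ℤ) - (j : ℤ)|) (a b : FreeGroup (Gen n))
      (ha : a = FreeGroup.of (Gen.sigma i hi₁ hi₂))
      (hb : b = FreeGroup.of (Gen.sigma j hj₁ hj₂)) :
      BraidRelator n (a * b * (b * a)⁻¹)
  | tau_braid (h : 1 < n) (t a : FreeGroup (Gen n))
      (ht : t = FreeGroup.of (Gen.tau h.le))
      (ha : a = FreeGroup.of (Gen.sigma 1 le_rfl h)) :
      BraidRelator n (t * a * t * a * (a * t * a * t)⁻¹)
  | tau_comm (i : ℕ) (h₁ : 1 < i) (h₂ : i < n) (t a : FreeGroup (Gen n))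
      (ht : t = FreeGroup.of (Gen.tau (by omega)))
      (ha : a = FreeGroup.of (Gen.sigma i h₁.le h₂)) :
      BraidRelator n (t * a * (a * t)⁻¹)

/-- The braid group of type B. -/
abbrev BraidGroupB (n : ℕ) : Type := PresentedGroup {w | BraidRelator n w}

variable {R : Type*} [CommRing R] {m : ℕ}

/-- A generator of the braid group, in the group algebra. -/
noncomputable def groupGen (R : Type*) [CommRing R] {n : ℕ} (g : Gen n) : MonoidAlgebra R (BraidGroupB n) :=
  MonoidAlgebra.of R (BraidGroupB n) (PresentedGroup.of g)

/-- The quadratic relations, which define the affine Hecke algebra. -/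
inductive AffineRel (q : Rˣ) (n : ℕ) :
    MonoidAlgebra R (BraidGroupB n) → MonoidAlgebra R (BraidGroupB n) → Prop
  | quadratic (i : ℕ) (h₁ : 1 ≤ i) (h₂ : i < n) :
      AffineRel q n
        (groupGen R (Gen.sigma i h₁ h₂) ^ 2)
        (((q : R) - ((q⁻¹ : Rˣ) : R)) • groupGen R (Gen.sigma i h₁ h₂) + 1)

/-- The affine Hecke algebra. -/
abbrev AffineHecke (q : Rˣ) (n : ℕ) : Type _ := RingQuot (AffineRel q n)

/-- A generator of the affine Hecke algebra. -/
noncomputable def affineGen (q : Rˣ) {n : ℕ} (g : Gen n) : AffineHecke q n :=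
  RingQuot.mkAlgHom R (AffineRel q n) (groupGen R g)

/-- The relation `(τ - v_1) ⋯ (τ - v_m) = 0` in the affine Hecke algebra. -/
inductive CyclotomicRel (q : Rˣ) (v : Fin m → R) (n : ℕ) :
    AffineHecke q n → AffineHecke q n → Prop
  | cyclotomic (h : 1 ≤ n) :
      CyclotomicRel q v n
        (List.ofFn fun a : Fin m => affineGen q (Gen.tau h) - algebraMap R _ (v a)).prod 0

/-- The cyclotomic quotient of the affine Hecke algebra. -/
abbrev GroupQuotient (q : Rˣ) (v : Fin m → R) (n : ℕ) : Type _ :=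
  RingQuot (CyclotomicRel q v n)

/-- A generator of the cyclotomic quotient of the affine Hecke algebra. -/
noncomputable def quotientGen (q : Rˣ) (v : Fin m → R) {n : ℕ} (g : Gen n) : GroupQuotient q v n :=
  RingQuot.mkAlgHom R (CyclotomicRel q v n) (affineGen q g)

theorem cyclotomic_eq (q : Rˣ) (v : Fin m → R) {n : ℕ} (h : 1 ≤ n) :
    (List.ofFn fun a : Fin m =>
      tau q v h - algebraMap R (CyclotomicHecke q v n) (v a)).prod = 0 := by
  have h' := RingQuot.mkAlgHom_rel R (Rel.cyclotomic (q := q) (v := v) h)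
  rw [map_zero, map_list_prod, List.map_ofFn] at h'
  rw [← h']
  congr 2
  funext a
  simp only [Function.comp, map_sub, AlgHom.commutes]
  rfl

theorem isUnit_tau (q : Rˣ) (v : Fin m → R) {n : ℕ} (hv : ∀ a, IsUnit (v a)) (h : 1 ≤ n) :
    IsUnit (tau q v h) := by
  set p : Polynomial R :=
    (List.ofFn fun a : Fin m => Polynomial.X - Polynomial.C (v a)).prod with hp
  have h0 : Polynomial.aeval (tau q v h) p = 0 := by
    rw [hp, map_list_prod, List.map_ofFn, ← cyclotomic_eq q v h]
    congr 2
    funext a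
    simp only [Function.comp, map_sub, Polynomial.aeval_X, Polynomial.aeval_C]
  have hc : IsUnit (p.coeff 0) := by
    have : p.coeff 0 = ∏ a, (-v a) := by
      rw [Polynomial.coeff_zero_eq_eval_zero, hp, List.prod_ofFn, Polynomial.eval_prod]
      simp
    rw [this, IsUnit.prod_univ_iff]
    exact fun a => (hv a).neg
  obtain ⟨u, hu⟩ := hc
  have key : tau q v h * Polynomial.aeval (tau q v h) p.divX =
      algebraMap R _ (-(u : R)) := by
    have e := congrArg (Polynomial.aeval (tau q v h)) (Polynomial.X_mul_divX_add p)
    rw [map_add, map_mul, Polynomial.aeval_X, Polynomial.aeval_C, h0, ← hu] at e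
    rw [map_neg]
    exact eq_neg_of_add_eq_zero_left e
  have hcomm : Commute (tau q v h) (Polynomial.aeval (tau q v h) p.divX) := by
    have e : Polynomial.X * p.divX = p.divX * Polynomial.X := mul_comm _ _
    have e' := congrArg (Polynomial.aeval (tau q v h)) e
    simp only [map_mul, Polynomial.aeval_X] at e'
    exact e'
  have hu' : IsUnit (tau q v h * Polynomial.aeval (tau q v h) p.divX) := by
    rw [key]
    exact (u.isUnit.neg).map (algebraMap R _)
  exact (hcomm.isUnit_mul_iff.mp hu').1

/-- A generator of `H(m,1,n)` as a unit, when the `v_a` are invertible. -/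
noncomputable def unitGen (q : Rˣ) (v : Fin m → R) {n : ℕ} (hv : ∀ a, IsUnit (v a)) :
    Gen n → (CyclotomicHecke q v n)ˣ
  | Gen.tau h => (isUnit_tau q v hv h).unit
  | Gen.sigma i h₁ h₂ => sigma q v i h₁ h₂

theorem unitGen_val (q : Rˣ) (v : Fin m → R) {n : ℕ} (hv : ∀ a, IsUnit (v a)) (g : Gen n) :
    (unitGen q v hv g : CyclotomicHecke q v n) =
      RingQuot.mkAlgHom R (Rel q v n) (FreeAlgebra.ι R g) := by
  cases g <;> rfl

theorem unitGen_relator (q : Rˣ) (v : Fin m → R) {n : ℕ} (hv : ∀ a, IsUnit (v a)) :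
    ∀ w ∈ {w | BraidRelator n w}, FreeGroup.lift (unitGen q v hv) w = 1 := by
  rintro w (⟨i, h₁, h₂, a, b, rfl, rfl⟩ | ⟨i, j, hi₁, hi₂, hj₁, hj₂, hij, a, b, rfl, rfl⟩ |
    ⟨h, t, a, rfl, rfl⟩ | ⟨i, h₁, h₂, t, a, rfl, rfl⟩)
  all_goals
    rw [map_mul, map_inv, mul_inv_eq_one]
    simp only [map_mul, FreeGroup.lift_apply_of]
    apply Units.ext
    simp only [Units.val_mul, unitGen_val, ← map_mul]
    apply RingQuot.mkAlgHom_rel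
  · exact Rel.braid i h₁ h₂
  · exact Rel.comm i j hi₁ hi₂ hj₁ hj₂ hij
  · exact Rel.tau_braid h
  · exact Rel.tau_comm i h₁ h₂

theorem groupGen_relation {n : ℕ} {a b : FreeGroup (Gen n)} (h : BraidRelator n (a * b⁻¹)) :
    MonoidAlgebra.of R (BraidGroupB n) (PresentedGroup.mk {w | BraidRelator n w} a) =
      MonoidAlgebra.of R (BraidGroupB n) (PresentedGroup.mk {w | BraidRelator n w} b) := by
  congr 1
  have := PresentedGroup.mk_eq_one_iff.mpr
    (Subgroup.subset_normalClosure (s := {w | BraidRelator n w}) h)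
  rwa [map_mul, map_inv, mul_inv_eq_one] at this

/-- The algebra map from the presented algebra to the quotient of the group algebra. -/
noncomputable def toGroupQuotient (q : Rˣ) (v : Fin m → R) (n : ℕ) :
    CyclotomicHecke q v n →ₐ[R] GroupQuotient q v n :=
  RingQuot.liftAlgHom R ⟨FreeAlgebra.lift R (quotientGen q v), by
    have rel {a b : FreeGroup (Gen n)} (h : BraidRelator n (a * b⁻¹)) :=
      congrArg (fun z => RingQuot.mkAlgHom R (CyclotomicRel q v n)
        (RingQuot.mkAlgHom R (AffineRel q n) z)) (groupGen_relation (R := R) h)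
    rintro x y (⟨i, h₁, h₂⟩ | ⟨i, j, hi₁, hi₂, hj₁, hj₂, hij⟩ | ⟨h⟩ | ⟨i, h₁, h₂⟩ |
      ⟨i, h₁, h₂⟩ | ⟨h⟩)
    · have := rel (BraidRelator.braid i h₁ h₂ _ _ rfl rfl)
      simp only [map_mul] at this
      simp only [map_mul, freeSigma, FreeAlgebra.lift_ι_apply]
      exact this
    · have := rel (BraidRelator.comm i j hi₁ hi₂ hj₁ hj₂ hij _ _ rfl rfl)
      simp only [map_mul] at this
      simp only [map_mul, freeSigma, FreeAlgebra.lift_ι_apply]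
      exact this
    · have := rel (BraidRelator.tau_braid h _ _ rfl rfl)
      simp only [map_mul] at this
      simp only [map_mul, freeSigma, freeTau, FreeAlgebra.lift_ι_apply]
      exact this
    · have := rel (BraidRelator.tau_comm i h₁ h₂ _ _ rfl rfl)
      simp only [map_mul] at this
      simp only [map_mul, freeSigma, freeTau, FreeAlgebra.lift_ι_apply]
      exact this
    · have := congrArg (RingQuot.mkAlgHom R (CyclotomicRel q v n))
        (RingQuot.mkAlgHom_rel R (AffineRel.quadratic (q := q) i h₁ h₂))
      simp only [map_pow, map_add, map_smul, map_one] at this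
      simp only [map_pow, map_add, map_smul, map_one, freeSigma, FreeAlgebra.lift_ι_apply]
      exact this
    · have := RingQuot.mkAlgHom_rel R (CyclotomicRel.cyclotomic (q := q) (v := v) h)
      rw [map_zero, map_list_prod, List.map_ofFn] at this
      rw [map_zero, map_list_prod, List.map_ofFn, ← this]
      congr 2
      funext a
      simp only [Function.comp, map_sub, AlgHom.commutes, freeTau, FreeAlgebra.lift_ι_apply]
      rfl⟩

/-- The algebra map from the affine Hecke algebra to the presented algebra. -/
noncomputable def ofAffine (q : Rˣ) (v : Fin m → R) (n : ℕ) (hv : ∀ a, IsUnit (v a)) :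
    AffineHecke q n →ₐ[R] CyclotomicHecke q v n :=
  RingQuot.liftAlgHom R ⟨MonoidAlgebra.lift R _ (BraidGroupB n)
    ((Units.coeHom _).comp (PresentedGroup.toGroup (unitGen_relator q v hv))), by
    rintro x y ⟨i, h₁, h₂⟩
    simp only [map_pow, map_add, map_smul, map_one, groupGen, MonoidAlgebra.lift_of,
      MonoidHom.comp_apply, PresentedGroup.toGroup.of]
    exact sigmaElt_sq q v i h₁ h₂⟩

theorem ofAffine_gen (q : Rˣ) (v : Fin m → R) {n : ℕ} (hv : ∀ a, IsUnit (v a)) (g : Gen n) :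
    ofAffine q v n hv (affineGen q g) =
      RingQuot.mkAlgHom R (Rel q v n) (FreeAlgebra.ι R g) := by
  rw [← unitGen_val q v hv]
  simp only [ofAffine, affineGen, groupGen, RingQuot.liftAlgHom_mkAlgHom_apply,
    MonoidAlgebra.lift_of, MonoidHom.comp_apply, PresentedGroup.toGroup.of]
  rfl

/-- The algebra map from the quotient of the group algebra to the presented algebra. -/
noncomputable def ofGroupQuotient (q : Rˣ) (v : Fin m → R) (n : ℕ) (hv : ∀ a, IsUnit (v a)) :
    GroupQuotient q v n →ₐ[R] CyclotomicHecke q v n :=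
  RingQuot.liftAlgHom R ⟨ofAffine q v n hv, by
    rintro x y ⟨h⟩
    rw [map_zero, map_list_prod, List.map_ofFn, ← cyclotomic_eq q v h]
    congr 2
    funext a
    simp only [Function.comp, map_sub, AlgHom.commutes, ofAffine_gen]
    rfl⟩

theorem toGroupQuotient_gen (q : Rˣ) (v : Fin m → R) {n : ℕ} (g : Gen n) :
    toGroupQuotient q v n (RingQuot.mkAlgHom R (Rel q v n) (FreeAlgebra.ι R g)) =
      quotientGen q v g := by
  simp only [toGroupQuotient, RingQuot.liftAlgHom_mkAlgHom_apply, FreeAlgebra.lift_ι_apply]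

theorem ofGroupQuotient_gen (q : Rˣ) (v : Fin m → R) {n : ℕ} (hv : ∀ a, IsUnit (v a))
    (g : Gen n) :
    ofGroupQuotient q v n hv (quotientGen q v g) =
      RingQuot.mkAlgHom R (Rel q v n) (FreeAlgebra.ι R g) := by
  simp only [ofGroupQuotient, quotientGen, RingQuot.liftAlgHom_mkAlgHom_apply, ofAffine_gen]

/-- If all `v_a` are invertible, the algebra given by generators and relations is the cyclotomic
quotient of the affine Hecke algebra, with the same generators. -/
theorem exists_equiv_groupQuotient (q : Rˣ) (v : Fin m → R) (n : ℕ) (hv : ∀ a, IsUnit (v a)) :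
    ∃ e : CyclotomicHecke q v n ≃ₐ[R] GroupQuotient q v n,
      (∀ h : 1 ≤ n, e (tau q v h) = quotientGen q v (Gen.tau h)) ∧
      (∀ (i : ℕ) (h₁ : 1 ≤ i) (h₂ : i < n),
        e (sigma q v i h₁ h₂ : CyclotomicHecke q v n) = quotientGen q v (Gen.sigma i h₁ h₂)) := by
  refine ⟨AlgEquiv.ofAlgHom (toGroupQuotient q v n) (ofGroupQuotient q v n hv) ?_ ?_,
    fun h => toGroupQuotient_gen q v _, fun i h₁ h₂ => toGroupQuotient_gen q v _⟩
  · apply RingQuot.ringQuot_ext'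
    apply RingQuot.ringQuot_ext'
    refine MonoidAlgebra.algHom_ext' ?_ (Subsingleton.elim _ _)
    have hom : ∀ f g : BraidGroupB n →* GroupQuotient q v n,
        (∀ x, f (PresentedGroup.of x) = g (PresentedGroup.of x)) → f = g := by
      intro f g hfg
      have : f.toHomUnits = g.toHomUnits := by
        apply PresentedGroup.ext
        intro x
        exact Units.ext (hfg x)
      ext x
      exact congrArg Units.val (DFunLike.congr_fun this x)
    apply hom
    intro g
    exact (congrArg (toGroupQuotient q v n) (ofGroupQuotient_gen q v hv g)).trans
      (toGroupQuotient_gen q v g)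
  · apply RingQuot.ringQuot_ext'
    apply FreeAlgebra.hom_ext
    funext g
    exact (congrArg (ofGroupQuotient q v n hv) (toGroupQuotient_gen q v g)).trans
      (ofGroupQuotient_gen q v hv g)

end GroupQuotient

end CyclotomicHecke

/-
Write `H_n` for `H(m,1,n)`, `f` for `(X - v_1) ⋯ (X - v_m)` and `B` for `R[X]/(f) ⊗ H_n`. Reading
`e_j (p ⊗ c)` as `σ_j⁻¹ ⋯ σ_1⁻¹ p(τ) σ_1 ⋯ σ_n c`, one is led to explicit operators on
`⊕_{j ≤ n} B`, with basis vectors `e_j`, through which `τ, σ_1, …, σ_n` should act. They satisfy the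
defining relations of `H_{n+1}`, so `⊕_{j ≤ n} B` is an `H_{n+1}`-module, and the reading is an
equivariant map from it to `H_{n+1}`. It sends `e_n 1` to `σ_n⁻¹ ⋯ σ_1⁻¹ σ_1 ⋯ σ_n = 1`, and
`z ↦ z • e_n 1` is its two-sided inverse. Since `R[X]/(f)` has the basis `1, X, …, X ^ (m - 1)`, the
isomorphism `⊕_{j ≤ n} B ≃ H_{n+1}` turns a basis of `H_n` by normal words into one of `H_{n+1}`.

The relation `f(τ) = 0` for the operators holds on `e_0` because `f(X) = 0` in `B`, and on `e_1 c`
for `c` in `H_n` because `f(τ) = 0` in `H_n`; it spreads from there along the operators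
`σ_1 τ σ_1` and `σ_i`, `i ≥ 2`, which commute with `τ`.
-/

open Polynomial TensorProduct

namespace CyclotomicHecke

section HeckeFamily

variable {R H : Type*} [CommRing R] [Ring H] [Algebra R H]

/-- Elements `s 1, …, s (n - 1)` of an algebra satisfying the defining relations of the Hecke
algebra of type A, where `h` stands for `q - q⁻¹`. The values of `s` at other indices are
irrelevant. -/
structure IsHeckeFamily (h : R) (n : ℕ) (s : ℕ → H) : Prop where
  braid : ∀ i, 1 ≤ i → i + 1 < n → s i * s (i + 1) * s i = s (i + 1) * s i * s (i + 1)
  comm : ∀ i j, 1 ≤ i → i + 1 < j → j < n → s i * s j = s j * s i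
  quadratic : ∀ i, 1 ≤ i → i < n → s i * s i = h • s i + 1

/-- A Hecke family `s 1, …, s (n - 1)` together with an element `t` satisfying the mixed relations
of the braid group of type B. No relation constrains `t` alone. -/
structure IsAffineHeckeFamily (h : R) (n : ℕ) (t : H) (s : ℕ → H) : Prop
    extends IsHeckeFamily h n s where
  tau_braid : 1 < n → t * s 1 * t * s 1 = s 1 * t * s 1 * t
  tau_comm : ∀ i, 1 < i → i < n → t * s i = s i * t

/-- The product `s_j⁻¹ ⋯ s_1⁻¹`, with `s_i⁻¹` written as `s_i - h`. -/
def descInvProd (h : R) (s : ℕ → H) : ℕ → H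
  | 0 => 1
  | j + 1 => (s (j + 1) - h • 1) * descInvProd h s j

/-- The product `s_1 ⋯ s_j`. -/
def ascProd {H : Type*} [Monoid H] (s : ℕ → H) : ℕ → H
  | 0 => 1
  | j + 1 => ascProd s j * s (j + 1)

theorem map_descInvProd {H' : Type*} [Ring H'] [Algebra R H'] (φ : H →ₐ[R] H') (h : R)
    {s : ℕ → H} {s' : ℕ → H'} {j : ℕ} (hφ : ∀ i, 1 ≤ i → i ≤ j → φ (s i) = s' i) :
    φ (descInvProd h s j) = descInvProd h s' j := by
  induction j with
  | zero => exact map_one φ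
  | succ j ih =>
    rw [descInvProd, map_mul, map_sub, map_smul, map_one, hφ _ (by omega) le_rfl,
      ih fun i h₁ h₂ => hφ i h₁ (by omega), descInvProd]

theorem map_ascProd {H H' F : Type*} [Monoid H] [Monoid H'] [FunLike F H H']
    [MonoidHomClass F H H'] (φ : F) {s : ℕ → H} {s' : ℕ → H'} {j : ℕ}
    (hφ : ∀ i, 1 ≤ i → i ≤ j → φ (s i) = s' i) :
    φ (ascProd s j) = ascProd s' j := by
  induction j with
  | zero => exact map_one φ
  | succ j ih =>
    rw [ascProd, map_mul, hφ _ (by omega) le_rfl, ih fun i h₁ h₂ => hφ i h₁ (by omega), ascProd]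

theorem commute_descInvProd {z : H} (h : R) {s : ℕ → H} {j : ℕ}
    (hz : ∀ i, 1 ≤ i → i ≤ j → Commute z (s i)) : Commute z (descInvProd h s j) := by
  induction j with
  | zero => exact Commute.one_right z
  | succ j ih =>
    exact ((hz _ (by omega) le_rfl).sub_right ((Commute.one_right z).smul_right h)).mul_right
      (ih fun i h₁ h₂ => hz i h₁ (by omega))

theorem commute_ascProd {H : Type*} [Monoid H] {z : H} {s : ℕ → H} {j : ℕ}
    (hz : ∀ i, 1 ≤ i → i ≤ j → Commute z (s i)) : Commute z (ascProd s j) := by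
  induction j with
  | zero => exact Commute.one_right z
  | succ j ih =>
    exact (ih fun i h₁ h₂ => hz i h₁ (by omega)).mul_right (hz _ (by omega) le_rfl)

theorem mul_descInvProd (h : R) (s : ℕ → H) (j : ℕ) :
    s (j + 1) * descInvProd h s j = descInvProd h s (j + 1) + h • descInvProd h s j := by
  rw [descInvProd, sub_mul, smul_mul_assoc, one_mul, sub_add_cancel]

namespace IsHeckeFamily

variable {h : R} {n : ℕ} {s : ℕ → H}

theorem mono (hs : IsHeckeFamily h n s) {k : ℕ} (hk : k ≤ n) : IsHeckeFamily h k s where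
  braid i h₁ h₂ := hs.braid i h₁ (by omega)
  comm i j h₁ h₂ h₃ := hs.comm i j h₁ h₂ (by omega)
  quadratic i h₁ h₂ := hs.quadratic i h₁ (by omega)

theorem map (hs : IsHeckeFamily h n s) {H' : Type*} [Ring H'] [Algebra R H'] (φ : H →ₐ[R] H') :
    IsHeckeFamily h n fun i => φ (s i) where
  braid i h₁ h₂ := by simpa using congrArg φ (hs.braid i h₁ h₂)
  comm i j h₁ h₂ h₃ := by simpa using congrArg φ (hs.comm i j h₁ h₂ h₃)
  quadratic i h₁ h₂ := by simpa using congrArg φ (hs.quadratic i h₁ h₂)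

theorem mul_mul_self (hs : IsHeckeFamily h n s) {i : ℕ} (h₁ : 1 ≤ i) (h₂ : i < n) (c : H) :
    s i * (s i * c) = h • (s i * c) + c := by
  rw [← mul_assoc, hs.quadratic i h₁ h₂, add_mul, smul_mul_assoc, one_mul]

theorem mul_inv_eq_one (hs : IsHeckeFamily h n s) {i : ℕ} (h₁ : 1 ≤ i) (h₂ : i < n) :
    s i * (s i - h • 1) = 1 := by
  rw [mul_sub, hs.quadratic i h₁ h₂, mul_smul_comm, mul_one, add_sub_cancel_left]

theorem inv_mul_eq_one (hs : IsHeckeFamily h n s) {i : ℕ} (h₁ : 1 ≤ i) (h₂ : i < n) :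
    (s i - h • 1) * s i = 1 := by
  rw [sub_mul, hs.quadratic i h₁ h₂, smul_mul_assoc, one_mul, add_sub_cancel_left]

theorem mul_descInvProd_succ (hs : IsHeckeFamily h n s) {j : ℕ} (hj : j + 1 < n) :
    s (j + 1) * descInvProd h s (j + 1) = descInvProd h s j := by
  rw [descInvProd, ← mul_assoc, hs.mul_inv_eq_one (by omega) hj, one_mul]

theorem mul_descInvProd_of_gt (hs : IsHeckeFamily h n s) {i j : ℕ} (hij : j + 1 < i)
    (hi : i < n) : s i * descInvProd h s j = descInvProd h s j * s i :=
  commute_descInvProd h fun k hk hk' => (hs.comm k i hk (by omega) hi).symm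

theorem mul_inv_mul_inv (hs : IsHeckeFamily h n s) {i : ℕ} (h₁ : 1 ≤ i) (h₂ : i + 1 < n) :
    s i * ((s (i + 1) - h • 1) * (s i - h • 1)) =
      (s (i + 1) - h • 1) * (s i - h • 1) * s (i + 1) := by
  have inv_mul := hs.inv_mul_eq_one (i := i + 1) (by omega) h₂
  have inv_mul' := hs.inv_mul_eq_one h₁ (by omega : i < n)
  have mul_inv := hs.mul_inv_eq_one (i := i + 1) (by omega) h₂
  have mul_inv' := hs.mul_inv_eq_one h₁ (by omega : i < n)
  set b := s (i + 1) - h • 1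
  set c := s i - h • 1
  have conj : b * c * (s (i + 1) * s i * s (i + 1)) = s i := by
    rw [← hs.braid i h₁ h₂, mul_assoc (s i), mul_assoc b, ← mul_assoc c, inv_mul', one_mul,
      ← mul_assoc, inv_mul, one_mul]
  calc s i * (b * c) = b * c * (s (i + 1) * s i * s (i + 1)) * (b * c) := by rw [conj]
    _ = b * c * s (i + 1) * (s i * (s (i + 1) * b) * c) := by simp only [mul_assoc]
    _ = b * c * s (i + 1) := by rw [mul_inv, mul_one, mul_inv', mul_one]

theorem mul_descInvProd_of_lt (hs : IsHeckeFamily h n s) {i j : ℕ} (hi : 1 ≤ i) (hij : i < j)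
    (hj : j < n) : s i * descInvProd h s j = descInvProd h s j * s (i + 1) := by
  induction j, hij using Nat.le_induction with
  | base =>
    obtain ⟨i, rfl⟩ : ∃ k, i = k + 1 := ⟨i - 1, by omega⟩
    have hcomm := hs.mul_descInvProd_of_gt (i := i + 1 + 1) (j := i) (by omega) hj
    rw [Nat.succ_eq_add_one, descInvProd, descInvProd, ← mul_assoc _ _ (descInvProd h s i),
      ← mul_assoc, hs.mul_inv_mul_inv hi hj, mul_assoc, hcomm, ← mul_assoc]
  | succ j hij ih =>
    rw [descInvProd, mul_assoc, ← ih (by omega), ← mul_assoc, ← mul_assoc, mul_sub,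
      sub_mul (s (j + 1)), hs.comm i (j + 1) hi (by omega) hj, mul_smul_comm, smul_mul_assoc,
      mul_one, one_mul]

theorem mul_ascProd_of_lt (hs : IsHeckeFamily h n s) {i j : ℕ} (hi : 1 ≤ i) (hij : i < j)
    (hj : j < n) : s (i + 1) * ascProd s j = ascProd s j * s i := by
  induction j, hij using Nat.le_induction with
  | base =>
    obtain ⟨i, rfl⟩ : ∃ k, i = k + 1 := ⟨i - 1, by omega⟩
    have hcomm : Commute (s (i + 1 + 1)) (ascProd s i) :=
      commute_ascProd fun k hk hk' => (hs.comm k (i + 1 + 1) hk (by omega) hj).symm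
    rw [Nat.succ_eq_add_one, ascProd, ascProd, ← mul_assoc, ← mul_assoc, hcomm.eq,
      mul_assoc, mul_assoc, ← mul_assoc (s (i + 1 + 1)), ← hs.braid (i + 1) hi hj]
    simp only [mul_assoc]
  | succ j hij ih =>
    rw [ascProd, ← mul_assoc, ih (by omega), mul_assoc, mul_assoc,
      hs.comm i (j + 1) hi (by omega) hj]

theorem descInvProd_mul_ascProd (hs : IsHeckeFamily h n s) {j : ℕ} (hj : j < n) :
    descInvProd h s j * ascProd s j = 1 := by
  induction j with
  | zero => exact mul_one 1
  | succ j ih =>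
    rw [descInvProd, ascProd, mul_assoc, ← mul_assoc (descInvProd h s j), ih (by omega), one_mul,
      hs.inv_mul_eq_one (by omega) hj]

end IsHeckeFamily

namespace IsAffineHeckeFamily

variable {h : R} {n : ℕ} {t : H} {s : ℕ → H}

theorem mono (hs : IsAffineHeckeFamily h n t s) {k : ℕ} (hk : k ≤ n) :
    IsAffineHeckeFamily h k t s where
  toIsHeckeFamily := hs.toIsHeckeFamily.mono hk
  tau_braid h₁ := hs.tau_braid (by omega)
  tau_comm i h₁ h₂ := hs.tau_comm i h₁ (by omega)

theorem commute_inv_mul_ascProd (hs : IsAffineHeckeFamily h n t s) {j : ℕ} (hj₁ : 1 ≤ j)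
    (hj₂ : j < n) : Commute t ((s 1 - h • 1) * ascProd s j) := by
  induction j, hj₁ using Nat.le_induction with
  | base =>
    rw [ascProd, ascProd, one_mul, hs.inv_mul_eq_one le_rfl hj₂]
    exact Commute.one_right t
  | succ j hj ih =>
    rw [ascProd, ← mul_assoc]
    exact (ih (by omega)).mul_right (hs.tau_comm (j + 1) (by omega) hj₂)

theorem tau_mul_sigma_mul_ascProd (hs : IsAffineHeckeFamily h n t s) {j : ℕ} (hj₁ : 1 ≤ j)
    (hj₂ : j < n) :
    t * s 1 * ascProd s j = (s 1 - h • 1) * ascProd s j * t + h • (t * ascProd s j) := by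
  rw [← (hs.commute_inv_mul_ascProd hj₁ hj₂).eq]
  simp only [mul_assoc, sub_mul, mul_sub, smul_mul_assoc, mul_smul_comm, one_mul, sub_add_cancel]

theorem tau_mul_sigma_mul_tau_mul_ascProd (hs : IsAffineHeckeFamily h n t s) {j : ℕ}
    (hj₁ : 1 ≤ j) (hj₂ : j < n) :
    t * s 1 * t * ascProd s j = s 1 * t * ascProd s j * t := by
  have comm := hs.commute_inv_mul_ascProd hj₁ hj₂
  have split : ascProd s j = s 1 * ((s 1 - h • 1) * ascProd s j) := by
    rw [← mul_assoc, hs.mul_inv_eq_one le_rfl (by omega), one_mul]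
  rw [split, ← mul_assoc, hs.tau_braid (by omega), mul_assoc _ t, comm.eq]
  simp only [mul_assoc]

end IsAffineHeckeFamily

end HeckeFamily

section BlockSum

variable {R B M : Type*} [CommSemiring R] [AddCommMonoid B] [Module R B] [AddCommMonoid M]
  [Module R M]

/-- The inclusion `b ↦ e_j b` of the `j`-th summand into `⊕_{j ≤ n} B`. It is `0` for `n < j`,
so that indices can be natural numbers. -/
def blockIncl (R : Type*) {B : Type*} [CommSemiring R] [AddCommMonoid B] [Module R B]
    (n j : ℕ) : B →ₗ[R] (Fin (n + 1) → B) :=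
  if hj : j < n + 1 then LinearMap.single R (fun _ => B) ⟨j, hj⟩ else 0

theorem blockIncl_val {n : ℕ} (j : Fin (n + 1)) :
    blockIncl R n j.val = LinearMap.single R (fun _ => B) j :=
  dif_pos j.isLt

/-- The linear map on `⊕_{j ≤ n} B` given by `F j` on the `j`-th summand. -/
def blockSum (n : ℕ) (F : ℕ → B →ₗ[R] M) : (Fin (n + 1) → B) →ₗ[R] M :=
  LinearMap.lsum R (fun _ => B) R fun j => F j

theorem blockSum_blockIncl {n j : ℕ} (hj : j ≤ n) (F : ℕ → B →ₗ[R] M) (b : B) :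
    blockSum n F (blockIncl R n j b) = F j b := by
  lift j to Fin (n + 1) using Nat.lt_succ_of_le hj
  rw [blockIncl_val]
  exact LinearMap.lsum_piSingle ..

theorem linearMap_ext_blockIncl {n : ℕ} {f g : (Fin (n + 1) → B) →ₗ[R] M}
    (hfg : ∀ j b, j ≤ n → f (blockIncl R n j b) = g (blockIncl R n j b)) : f = g :=
  LinearMap.pi_ext' fun j => LinearMap.ext fun b => by
    simpa only [blockIncl_val, LinearMap.comp_apply] using hfg j b (Nat.le_of_lt_succ j.isLt)

end BlockSum

section InducedModule

variable {R B : Type*} [CommRing R] [Ring B] [Algebra R B]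

/-- The operator by which `σ_i` acts on `⊕_{j ≤ n} B`, where `e_j b` stands for the element
`σ_j⁻¹ ⋯ σ_1⁻¹ τ^α σ_1 ⋯ σ_n c` when `b = τ^α ⊗ c`. -/
def sigmaOp (h : R) (n : ℕ) (s : ℕ → B) (i : ℕ) : Module.End R (Fin (n + 1) → B) :=
  blockSum n fun j =>
    if i < j then blockIncl R n j ∘ₗ LinearMap.mulLeft R (s i)
    else if i = j then blockIncl R n (i - 1)
    else if i = j + 1 then blockIncl R n i + h • blockIncl R n j
    else blockIncl R n j ∘ₗ LinearMap.mulLeft R (s (i - 1))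

section

variable (h : R) {n : ℕ} (s : ℕ → B)

theorem sigmaOp_blockIncl {j : ℕ} (hj : j ≤ n) (i : ℕ) (b : B) :
    sigmaOp h n s i (blockIncl R n j b) =
      if i < j then blockIncl R n j (s i * b)
      else if i = j then blockIncl R n (i - 1) b
      else if i = j + 1 then blockIncl R n i b + h • blockIncl R n j b
      else blockIncl R n j (s (i - 1) * b) := by
  rw [sigmaOp, blockSum_blockIncl hj]
  split_ifs <;> rfl

theorem sigmaOp_blockIncl_of_lt {i j : ℕ} (hij : i < j) (hj : j ≤ n) (b : B) :
    sigmaOp h n s i (blockIncl R n j b) = blockIncl R n j (s i * b) := by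
  rw [sigmaOp_blockIncl h s hj, if_pos hij]

theorem sigmaOp_succ_blockIncl_succ {j : ℕ} (hj : j < n) (b : B) :
    sigmaOp h n s (j + 1) (blockIncl R n (j + 1) b) = blockIncl R n j b := by
  rw [sigmaOp_blockIncl h s hj, if_neg (lt_irrefl _), if_pos rfl, Nat.add_sub_cancel]

theorem sigmaOp_succ_blockIncl {j : ℕ} (hj : j < n) (b : B) :
    sigmaOp h n s (j + 1) (blockIncl R n j b) =
      blockIncl R n (j + 1) b + h • blockIncl R n j b := by
  rw [sigmaOp_blockIncl h s hj.le, if_neg (by omega), if_neg (by omega), if_pos rfl]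

theorem sigmaOp_succ_blockIncl_of_lt {i j : ℕ} (hij : j < i) (hi : i < n) (b : B) :
    sigmaOp h n s (i + 1) (blockIncl R n j b) = blockIncl R n j (s i * b) := by
  rw [sigmaOp_blockIncl h s (by omega), if_neg (by omega), if_neg (by omega), if_neg (by omega),
    Nat.add_sub_cancel]

theorem blockIncl_succ {j : ℕ} (hj : j < n) (b : B) :
    blockIncl R n (j + 1) b = (sigmaOp h n s (j + 1) - h • 1) (blockIncl R n j b) := by
  rw [LinearMap.sub_apply, sigmaOp_succ_blockIncl h s hj, LinearMap.smul_apply,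
    Module.End.one_apply, add_sub_cancel_right]

theorem eq_on_blockIncl_succ {M : Type*} [AddCommGroup M] [Module R M] {j : ℕ} (hj : j < n)
    {f g : (Fin (n + 1) → B) →ₗ[R] M} (S : Module.End R M)
    (hf : ∀ φ, f (sigmaOp h n s (j + 1) φ) = S (f φ))
    (hg : ∀ φ, g (sigmaOp h n s (j + 1) φ) = S (g φ))
    (hfg : ∀ b, f (blockIncl R n j b) = g (blockIncl R n j b)) (b : B) :
    f (blockIncl R n (j + 1) b) = g (blockIncl R n (j + 1) b) := by
  simp only [blockIncl_succ h s hj, LinearMap.sub_apply, LinearMap.smul_apply,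
    Module.End.one_apply, map_sub, map_smul, hf, hg, hfg]

end

namespace IsHeckeFamily

variable {h : R} {n : ℕ} {s : ℕ → B}

theorem sigmaOp_mul_self (hs : IsHeckeFamily h n s) (i : ℕ) (h₁ : 1 ≤ i) (h₂ : i < n + 1) :
    sigmaOp h n s i * sigmaOp h n s i = h • sigmaOp h n s i + 1 := by
  obtain ⟨i, rfl⟩ : ∃ k, i = k + 1 := ⟨i - 1, by omega⟩
  refine linearMap_ext_blockIncl fun j b hj => ?_
  simp only [Module.End.mul_apply, LinearMap.add_apply, LinearMap.smul_apply, Module.End.one_apply]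
  rcases (show i + 1 < j ∨ j = i + 1 ∨ j = i ∨ j < i by omega) with hij | rfl | rfl | hij
  · simp only [sigmaOp_blockIncl_of_lt h s hij hj, map_add, map_smul,
      hs.mul_mul_self h₁ (show i + 1 < n by omega)]
  · rw [sigmaOp_succ_blockIncl_succ h s (by omega), sigmaOp_succ_blockIncl h s (by omega)]
    exact add_comm _ _
  · rw [sigmaOp_succ_blockIncl h s (by omega), map_add, map_smul,
      sigmaOp_succ_blockIncl_succ h s (by omega), sigmaOp_succ_blockIncl h s (by omega)]
    exact add_comm _ _
  · simp only [sigmaOp_succ_blockIncl_of_lt h s hij (show i < n by omega), map_add, map_smul,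
      hs.mul_mul_self (show 1 ≤ i by omega) (show i < n by omega)]

theorem sigmaOp_braid (hs : IsHeckeFamily h n s) (i : ℕ) (h₁ : 1 ≤ i) (h₂ : i + 1 < n + 1) :
    sigmaOp h n s i * sigmaOp h n s (i + 1) * sigmaOp h n s i =
      sigmaOp h n s (i + 1) * sigmaOp h n s i * sigmaOp h n s (i + 1) := by
  obtain ⟨i, rfl⟩ : ∃ k, i = k + 1 := ⟨i - 1, by omega⟩
  refine linearMap_ext_blockIncl fun j b hj => ?_
  simp only [Module.End.mul_apply]
  have hi : i + 1 < n := by omega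
  have lower_succ (b) := sigmaOp_succ_blockIncl_succ h s hi b
  have lower (b) := sigmaOp_succ_blockIncl_succ h s (show i < n by omega) b
  have raise_succ (b) := sigmaOp_succ_blockIncl h s hi b
  have raise (b) := sigmaOp_succ_blockIncl h s (show i < n by omega) b
  have mul_top (b) := sigmaOp_blockIncl_of_lt h s (show i + 1 < i + 1 + 1 by omega) hi b
  have mul_bot (b) := sigmaOp_succ_blockIncl_of_lt h s (show i < i + 1 by omega) hi b
  rcases (show i + 2 < j ∨ j = i + 2 ∨ j = i + 1 ∨ j = i ∨ j < i by omega) with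
    hij | rfl | rfl | rfl | hij
  · simp only [sigmaOp_blockIncl_of_lt h s (show i + 1 < j by omega) hj,
      sigmaOp_blockIncl_of_lt h s hij hj, ← mul_assoc, hs.braid _ h₁ (show i + 1 + 1 < n by omega)]
  · simp only [mul_top, lower_succ, lower, mul_bot]
  · simp only [lower, mul_bot, lower_succ, raise_succ, raise, mul_top, map_add, map_smul]
  · simp only [raise, mul_bot, raise_succ, lower, mul_top, hs.mul_mul_self h₁ hi, map_add, map_smul]
    module
  · simp only [sigmaOp_succ_blockIncl_of_lt h s hij (show i < n by omega),
      sigmaOp_succ_blockIncl_of_lt h s (show j < i + 1 by omega) hi, ← mul_assoc,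
      hs.braid i (by omega) hi]

theorem sigmaOp_comm (hs : IsHeckeFamily h n s) (i k : ℕ) (h₁ : 1 ≤ i) (h₂ : i + 1 < k)
    (h₃ : k < n + 1) :
    sigmaOp h n s i * sigmaOp h n s k = sigmaOp h n s k * sigmaOp h n s i := by
  obtain ⟨i, rfl⟩ : ∃ k, i = k + 1 := ⟨i - 1, by omega⟩
  obtain ⟨k, rfl⟩ : ∃ l, k = l + 1 := ⟨k - 1, by omega⟩
  refine linearMap_ext_blockIncl fun j b hj => ?_
  simp only [Module.End.mul_apply]
  have mul_above {j} (hij : i + 1 < j) (hj : j ≤ n) (b) := sigmaOp_blockIncl_of_lt h s hij hj b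
  have mul_below {j} (hjk : j < k) (b) :=
    sigmaOp_succ_blockIncl_of_lt h s hjk (show k < n by omega) b
  rcases (show k + 1 < j ∨ j = k + 1 ∨ j = k ∨ (i + 1 < j ∧ j < k) ∨ j = i + 1 ∨ j = i ∨ j < i
    by omega) with hkj | rfl | rfl | ⟨hij, hjk⟩ | rfl | rfl | hji
  · simp only [mul_above (show i + 1 < j by omega) hj, sigmaOp_blockIncl_of_lt h s hkj hj,
      ← mul_assoc, hs.comm _ _ h₁ h₂ (show k + 1 < n by omega)]
  · simp only [mul_above (show i + 1 < k + 1 by omega) hj,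
      mul_above (show i + 1 < k by omega) (by omega),
      sigmaOp_succ_blockIncl_succ h s (show k < n by omega)]
  · simp only [mul_above (show i + 1 < j + 1 by omega) (by omega),
      mul_above (show i + 1 < j by omega) hj, sigmaOp_succ_blockIncl h s (show j < n by omega),
      map_add, map_smul]
  · simp only [mul_above hij hj, mul_below hjk, ← mul_assoc,
      hs.comm (i + 1) k h₁ (by omega) (by omega)]
  · simp only [mul_below (show i + 1 < k by omega), mul_below (show i < k by omega),
      sigmaOp_succ_blockIncl_succ h s (show i < n by omega)]
  · simp only [mul_below (show j + 1 < k by omega), mul_below (show j < k by omega),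
      sigmaOp_succ_blockIncl h s (show j < n by omega), map_add, map_smul]
  · simp only [sigmaOp_succ_blockIncl_of_lt h s hji (show i < n by omega),
      mul_below (show j < k by omega), ← mul_assoc, hs.comm i k (by omega) (by omega) (by omega)]

theorem sigmaOp (hs : IsHeckeFamily h n s) : IsHeckeFamily h (n + 1) (sigmaOp h n s) where
  braid := hs.sigmaOp_braid
  comm := hs.sigmaOp_comm
  quadratic := hs.sigmaOp_mul_self

end IsHeckeFamily

end InducedModule

section PolynomialCalculus

variable {R A : Type*} [CommSemiring R] [Semiring A] [Algebra R A]

theorem commute_aeval_left {a z : A} (haz : Commute a z) (f : R[X]) : Commute (aeval a f) z :=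
  f.induction_on' (fun p p' hp hp' => by rw [map_add]; exact hp.add_left hp') fun k r => by
    rw [aeval_monomial]
    exact (Algebra.commute_algebraMap_left r z).mul_left (haz.pow_left k)

theorem aeval_apply_of_apply_mul {M : Type*} [AddCommMonoid M] [Module R M] {T : Module.End R M}
    {φ : A →ₗ[R] M} {a : A} (hT : ∀ b, T (φ b) = φ (a * b)) (f : R[X]) (b : A) :
    aeval T f (φ b) = φ (aeval a f * b) := by
  induction f using Polynomial.induction_on' with
  | add p p' hp hp' => rw [map_add, map_add, LinearMap.add_apply, hp, hp', add_mul, map_add]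
  | monomial k r =>
    have pow (k : ℕ) : (T ^ k) (φ b) = φ (a ^ k * b) := by
      induction k with
      | zero => simp only [pow_zero, Module.End.one_apply, one_mul]
      | succ k ih => rw [pow_succ', Module.End.mul_apply, ih, hT, ← mul_assoc, ← pow_succ']
    rw [aeval_monomial, aeval_monomial, Module.End.mul_apply, pow, mul_assoc,
      Module.algebraMap_end_apply, ← Algebra.smul_def, map_smul]

end PolynomialCalculus

section InductionDatum

variable {R H B : Type*} [CommRing R] [Ring H] [Algebra R H] [Ring B] [Algebra R B]

/-- The algebra `B` is generated by a copy `ι` of `H` and an element `x` commuting with it, and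
`x ↦ t` extends to a left `H`-linear evaluation `ev : B → H`; the model is `R[x]/(f) ⊗ H` with
`f(t) = 0`. In rank `n = 0` there is no `t`, hence nothing is required of `ev`. -/
structure IsInductionDatum (n : ℕ) (t : H) (x : B) (ι : H →ₐ[R] B) (ev : B →ₗ[R] H) : Prop where
  commute : ∀ c, Commute x (ι c)
  eq_top : ∀ p : AddSubmonoid B, (∀ c, ι c ∈ p) → (∀ b ∈ p, x * b ∈ p) → p = ⊤
  ev_root_mul : 1 ≤ n → ∀ b, ev (x * b) = t * ev b
  ev_coeff : 1 ≤ n → ∀ c, ev (ι c) = c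

/-- The operator by which `τ` acts on `⊕_{j ≤ n} B`, with the reading of `e_j b` explained at
`sigmaOp`. Writing `w b` for `e_0 b` read in this way, the term in `e_0` comes from the identity
`τ σ_1⁻¹ (w b) = σ_1⁻¹ (w (ι t * b)) + h τ (w (ι (ev b) - b))`. -/
def tauOp (h : R) (n : ℕ) (t : H) (s : ℕ → H) (x : B) (ι : H →ₐ[R] B) (ev : B →ₗ[R] H) :
    Module.End R (Fin (n + 1) → B) :=
  blockSum n fun
    | 0 => blockIncl R n 0 ∘ₗ LinearMap.mulLeft R x
    | j + 1 => blockIncl R n (j + 1) ∘ₗ LinearMap.mulLeft R (ι t) +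
        h • blockIncl R n 0 ∘ₗ LinearMap.mulLeft R (x * ι (descInvProd h s j)) ∘ₗ
          (ι.toLinearMap ∘ₗ ev - LinearMap.id)

section

variable (h : R) {n : ℕ} (t : H) (s : ℕ → H) (x : B) (ι : H →ₐ[R] B) (ev : B →ₗ[R] H)

theorem tauOp_blockIncl_zero (b : B) :
    tauOp h n t s x ι ev (blockIncl R n 0 b) = blockIncl R n 0 (x * b) := by
  rw [tauOp, blockSum_blockIncl n.zero_le, LinearMap.comp_apply, LinearMap.mulLeft_apply]

theorem tauOp_blockIncl_succ {j : ℕ} (hj : j < n) (b : B) :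
    tauOp h n t s x ι ev (blockIncl R n (j + 1) b) = blockIncl R n (j + 1) (ι t * b) +
      h • blockIncl R n 0 (x * (ι (descInvProd h s j) * (ι (ev b) - b))) := by
  rw [tauOp, blockSum_blockIncl hj]
  simp only [LinearMap.add_apply, LinearMap.smul_apply, LinearMap.comp_apply,
    LinearMap.sub_apply, LinearMap.mulLeft_apply, AlgHom.toLinearMap_apply, LinearMap.id_apply,
    mul_assoc]

theorem tauOp_blockIncl_one (hn : 1 ≤ n) (b : B) :
    tauOp h n t s x ι ev (blockIncl R n 1 b) =
      blockIncl R n 1 (ι t * b) + h • blockIncl R n 0 (x * (ι (ev b) - b)) := by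
  simpa only [descInvProd, map_one, one_mul] using tauOp_blockIncl_succ h t s x ι ev hn b

end

namespace IsInductionDatum

variable {n : ℕ} {t : H} {x : B} {ι : H →ₐ[R] B} {ev : B →ₗ[R] H}

theorem induction_on (hD : IsInductionDatum n t x ι ev) {P : B → Prop} (coeff : ∀ c, P (ι c))
    (add : ∀ b b', P b → P b' → P (b + b')) (root_mul : ∀ b, P b → P (x * b)) (b : B) : P b := by
  let p : AddSubmonoid B :=
    { carrier := {b | P b}, zero_mem' := map_zero ι ▸ coeff 0, add_mem' := add _ _ }
  exact (hD.eq_top p coeff root_mul).ge (AddSubmonoid.mem_top b)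

theorem coeff_mul_root_mul (hD : IsInductionDatum n t x ι ev) (c : H) (b : B) :
    ι c * (x * b) = x * (ι c * b) := by
  rw [← mul_assoc, ← (hD.commute c).eq, mul_assoc]

theorem ev_coeff_mul (hD : IsInductionDatum n t x ι ev) (hn : 1 ≤ n) {c : H} (hc : Commute c t)
    (b : B) : ev (ι c * b) = c * ev b := by
  induction b using hD.induction_on with
  | coeff c =>
    rw [← map_mul, hD.ev_coeff hn, hD.ev_coeff hn]
  | add b b' hb hb' =>
    rw [mul_add, map_add, map_add, hb, hb', mul_add]
  | root_mul b hb =>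
    rw [hD.coeff_mul_root_mul, hD.ev_root_mul hn, hD.ev_root_mul hn, hb, ← mul_assoc, ← hc.eq,
      mul_assoc]

variable {h : R} {s : ℕ → H}

-- Only products commuting with `t` can be pulled out of `ev`. One of them is `s 1 * t * s 1`, and
-- `s 1 * t` is its product with `s 1 - h`.
theorem ev_sigma_tau_mul (hD : IsInductionDatum n t x ι ev) (hs : IsAffineHeckeFamily h n t s)
    (hn : 1 < n) (b : B) : ev (ι (s 1) * (ι t * b)) =
      s 1 * (t * (s 1 * ev (ι (s 1) * b))) - h • (s 1 * (t * (s 1 * ev b))) := by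
  have comm : Commute (s 1 * t * s 1) t := by
    simpa only [Commute, SemiconjBy, mul_assoc] using (hs.tau_braid hn).symm
  have quadratic (b : B) := (hs.toIsHeckeFamily.map ι).mul_mul_self le_rfl hn b
  have key := hD.ev_coeff_mul hn.le comm (ι (s 1) * b - h • b)
  simpa only [map_mul, mul_assoc, mul_add, mul_sub, quadratic, mul_smul_comm,
    add_sub_cancel_left, map_sub, map_add, map_smul] using key

local notation "S" => sigmaOp h n (fun i => ι (s i))
local notation "T" => tauOp h n t s x ι ev

theorem tauOp_sigmaOp_blockIncl_of_lt (hD : IsInductionDatum n t x ι ev)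
    (hs : IsAffineHeckeFamily h n t s) {i j : ℕ} (h₁ : 0 < i) (hij : i < j) (hj : j < n) (b : B) :
    T (S (i + 1) (blockIncl R n (j + 1) b)) = S (i + 1) (T (blockIncl R n (j + 1) b)) := by
  have tau_succ (b) : T (blockIncl R n (j + 1) b) = _ := tauOp_blockIncl_succ h t s x ι ev hj b
  have mul_zero (b) := sigmaOp_succ_blockIncl_of_lt h (fun i => ι (s i)) h₁ (hij.trans hj) b
  have mul_block (b) := sigmaOp_blockIncl_of_lt h (fun i => ι (s i))
    (show i + 1 < j + 1 by omega) hj b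
  have tau_comm := hs.tau_comm (i + 1) (by omega) (by omega)
  have tau_comm_map := congrArg ι tau_comm
  have mul_desc := congrArg ι (hs.mul_descInvProd_of_lt h₁ hij hj)
  simp only [map_mul] at tau_comm_map mul_desc
  simp only [tau_succ, mul_block, mul_zero, map_add, map_smul, hD.coeff_mul_root_mul,
    hD.ev_coeff_mul (by omega) tau_comm.symm, map_mul]
  simp only [← mul_assoc, tau_comm_map, mul_desc, ← mul_sub]

theorem tauOp_sigmaOp_blockIncl_of_gt (hD : IsInductionDatum n t x ι ev)
    (hs : IsAffineHeckeFamily h n t s) {i j : ℕ} (hij : j + 1 < i) (hi : i < n) (b : B) :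
    T (S (i + 1) (blockIncl R n (j + 1) b)) = S (i + 1) (T (blockIncl R n (j + 1) b)) := by
  have tau_succ (b) : T (blockIncl R n (j + 1) b) = _ :=
    tauOp_blockIncl_succ h t s x ι ev (by omega) b
  have mul_zero (b) := sigmaOp_succ_blockIncl_of_lt h (fun i => ι (s i))
    (show 0 < i by omega) hi b
  have mul_block (b) := sigmaOp_succ_blockIncl_of_lt h (fun i => ι (s i)) hij hi b
  have tau_comm := hs.tau_comm i (by omega) hi
  have tau_comm_map := congrArg ι tau_comm
  have mul_desc := congrArg ι (hs.mul_descInvProd_of_gt hij hi)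
  simp only [map_mul] at tau_comm_map mul_desc
  simp only [tau_succ, mul_block, mul_zero, map_add, map_smul, hD.coeff_mul_root_mul,
    hD.ev_coeff_mul (by omega) tau_comm.symm, map_mul]
  simp only [← mul_assoc, tau_comm_map, mul_desc, ← mul_sub]

theorem tauOp_mul_sigmaOp (hD : IsInductionDatum n t x ι ev) (hs : IsAffineHeckeFamily h n t s)
    (i : ℕ) (h₁ : 1 < i) (h₂ : i < n + 1) : T * S i = S i * T := by
  obtain ⟨i, rfl⟩ : ∃ k, i = k + 1 := ⟨i - 1, by omega⟩
  refine linearMap_ext_blockIncl fun j b hj => ?_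
  simp only [Module.End.mul_apply]
  have hi : i < n := by omega
  have mul_zero (b) : S (i + 1) (blockIncl R n 0 b) = blockIncl R n 0 (ι (s i) * b) :=
    sigmaOp_succ_blockIncl_of_lt h _ (show 0 < i by omega) hi b
  obtain rfl | ⟨j, rfl⟩ : j = 0 ∨ ∃ k, j = k + 1 := by cases j <;> simp
  · simp only [mul_zero, tauOp_blockIncl_zero, hD.coeff_mul_root_mul]
  have tau_succ (b) : T (blockIncl R n (j + 1) b) = _ := tauOp_blockIncl_succ h t s x ι ev hj b
  rcases (show i < j ∨ i = j ∨ i = j + 1 ∨ j + 1 < i by omega) with hij | rfl | rfl | hij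
  · exact hD.tauOp_sigmaOp_blockIncl_of_lt hs (by omega) hij hj b
  · obtain ⟨i, rfl⟩ : ∃ k, i = k + 1 := ⟨i - 1, by omega⟩
    have lower (b) := sigmaOp_succ_blockIncl_succ h (fun i => ι (s i)) (show i + 1 < n by omega) b
    have mul_desc := congrArg ι (hs.mul_descInvProd_succ hi)
    rw [map_mul] at mul_desc
    simp only [tau_succ, lower, mul_zero, map_add, map_smul, hD.coeff_mul_root_mul,
      tauOp_blockIncl_succ h t s x ι ev (show i < n by omega)]
    rw [← mul_assoc (ι (s (i + 1))), mul_desc]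
  · have raise (b) := sigmaOp_succ_blockIncl h (fun i => ι (s i)) hi b
    have mul_desc := congrArg ι (mul_descInvProd h s j)
    rw [map_mul, map_add, map_smul] at mul_desc
    simp only [tau_succ, raise, mul_zero, map_add, map_smul, hD.coeff_mul_root_mul,
      tauOp_blockIncl_succ h t s x ι ev hi]
    rw [← mul_assoc (ι (s (j + 1))), mul_desc]
    simp only [add_mul, smul_mul_assoc, mul_add, mul_smul_comm, map_add, map_smul]
    module
  · exact hD.tauOp_sigmaOp_blockIncl_of_gt hs hij hi b

theorem tauOp_braid_blockIncl_zero_one (hD : IsInductionDatum n t x ι ev) (hn : 1 ≤ n) {j : ℕ}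
    (hj : j ≤ 1) (b : B) :
    (T * S 1 * T * S 1) (blockIncl R n j b) = (S 1 * T * S 1 * T) (blockIncl R n j b) := by
  have raise (b) := sigmaOp_succ_blockIncl h (fun i => ι (s i)) hn b
  have lower (b) := sigmaOp_succ_blockIncl_succ h (fun i => ι (s i)) hn b
  have tau_one (b) := tauOp_blockIncl_one h t s x ι ev hn b
  rw [zero_add] at raise lower
  obtain rfl | rfl := Nat.le_one_iff_eq_zero_or_eq_one.mp hj <;>
  · simp only [Module.End.mul_apply, raise, lower, tau_one, tauOp_blockIncl_zero, map_add,
      map_smul, hD.ev_root_mul hn, hD.ev_coeff hn, mul_sub, map_sub, map_mul,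
      hD.coeff_mul_root_mul]
    module

theorem tauOp_braid_blockIncl_two (hD : IsInductionDatum n t x ι ev)
    (hs : IsAffineHeckeFamily h n t s) (hn : 1 < n) (b : B) :
    (T * S 1 * T * S 1) (blockIncl R n 2 b) = (S 1 * T * S 1 * T) (blockIncl R n 2 b) := by
  have raise (b) := sigmaOp_succ_blockIncl h (fun i => ι (s i)) hn.le b
  have lower (b) := sigmaOp_succ_blockIncl_succ h (fun i => ι (s i)) hn.le b
  have mul_two (b) := sigmaOp_blockIncl_of_lt h (fun i => ι (s i)) one_lt_two hn b
  have tau_one (b) := tauOp_blockIncl_one h t s x ι ev hn.le b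
  have tau_two (b) := tauOp_blockIncl_succ h t s x ι ev hn b
  simp only [zero_add, descInvProd, mul_one, Nat.reduceAdd] at raise lower tau_two
  have quadratic (b : B) := (hs.toIsHeckeFamily.map ι).mul_mul_self le_rfl hn b
  have braid (b : B) : ι t * (ι (s 1) * (ι t * (ι (s 1) * b))) =
      ι (s 1) * (ι t * (ι (s 1) * (ι t * b))) := by
    simp only [← mul_assoc, ← map_mul, hs.tau_braid hn]
  have ev_sigma_coeff (c : H) : ev (ι (s 1) * ι c) = s 1 * c := by
    rw [← map_mul, hD.ev_coeff hn.le]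
  simp only [Module.End.mul_apply, raise, lower, mul_two, tau_one, tau_two, tauOp_blockIncl_zero,
    map_add, map_smul, map_sub, map_mul, map_one, sub_mul, smul_mul_assoc, one_mul,
    hD.ev_root_mul hn.le, hD.ev_coeff hn.le, ev_sigma_coeff, mul_add, mul_sub, mul_smul_comm,
    hD.coeff_mul_root_mul, hD.ev_sigma_tau_mul hs hn, quadratic, braid]
  module

theorem tauOp_braid (hD : IsInductionDatum n t x ι ev) (hs : IsAffineHeckeFamily h n t s)
    (hn : 1 < n + 1) : T * S 1 * T * S 1 = S 1 * T * S 1 * T := by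
  refine linearMap_ext_blockIncl fun j b hj => ?_
  obtain hj₁ | hj₂ : j ≤ 1 ∨ 2 ≤ j := by omega
  · exact hD.tauOp_braid_blockIncl_zero_one (by omega) hj₁ b
  induction j, hj₂ using Nat.le_induction generalizing b with
  | base => exact hD.tauOp_braid_blockIncl_two hs hj b
  | succ j hj₂ ih =>
    have comm_tau : Commute T (S (j + 1)) := hD.tauOp_mul_sigmaOp hs (j + 1) (by omega) (by omega)
    have comm_sigma : Commute (S 1) (S (j + 1)) :=
      (hs.toIsHeckeFamily.map ι).sigmaOp_comm 1 (j + 1) le_rfl (by omega) (by omega)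
    exact eq_on_blockIncl_succ h _ hj (S (j + 1))
      (LinearMap.congr_fun
        (((comm_tau.mul_left comm_sigma).mul_left comm_tau).mul_left comm_sigma).eq)
      (LinearMap.congr_fun
        (((comm_sigma.mul_left comm_tau).mul_left comm_sigma).mul_left comm_tau).eq)
      (fun b => ih b (by omega)) b

theorem isAffineHeckeFamily (hD : IsInductionDatum n t x ι ev)
    (hs : IsAffineHeckeFamily h n t s) : IsAffineHeckeFamily h (n + 1) T S where
  toIsHeckeFamily := (hs.toIsHeckeFamily.map ι).sigmaOp
  tau_braid := hD.tauOp_braid hs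
  tau_comm := hD.tauOp_mul_sigmaOp hs

theorem aeval_tauOp_eq_zero (hD : IsInductionDatum n t x ι ev)
    (hs : IsAffineHeckeFamily h n t s) {f : R[X]} (hx : aeval x f = 0)
    (ht : 1 ≤ n → aeval t f = 0) : aeval T f = 0 := by
  refine linearMap_ext_blockIncl fun j b hj => ?_
  have on_zero (b : B) : aeval T f (blockIncl R n 0 b) = 0 := by
    rw [aeval_apply_of_apply_mul (tauOp_blockIncl_zero h t s x ι ev), hx, zero_mul, map_zero]
  obtain rfl | hj₁ : j = 0 ∨ 1 ≤ j := by omega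
  · exact on_zero b
  induction j, hj₁ using Nat.le_induction generalizing b with
  | base =>
    rw [LinearMap.zero_apply]
    induction b using hD.induction_on with
    | coeff c =>
      have tau_coeff (c : H) : T ((blockIncl R n 1 ∘ₗ ι.toLinearMap) c) =
          (blockIncl R n 1 ∘ₗ ι.toLinearMap) (t * c) := by
        simp only [LinearMap.comp_apply, AlgHom.toLinearMap_apply,
          tauOp_blockIncl_one h t s x ι ev hj, hD.ev_coeff hj, sub_self, mul_zero, map_zero,
          smul_zero, add_zero, map_mul]
      exact (aeval_apply_of_apply_mul tau_coeff f c).trans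
        (by rw [ht hj, zero_mul, map_zero])
    | add b b' hb hb' =>
      rw [map_add, map_add, hb, hb', add_zero]
    | root_mul b hb =>
      have comm : Commute (aeval T f) (S 1 * T * S 1) := by
        refine commute_aeval_left ?_ f
        simpa only [Commute, SemiconjBy, mul_assoc] using hD.tauOp_braid hs (by omega)
      have hb' : blockIncl R n 1 (x * b) =
          (S 1 * T * S 1) (blockIncl R n 1 b) - h • blockIncl R n 0 (x * b) := by
        simp only [Module.End.mul_apply, sigmaOp_succ_blockIncl_succ h _ hj,
          sigmaOp_succ_blockIncl h _ hj, tauOp_blockIncl_zero, add_sub_cancel_right]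
      rw [hb', map_sub, map_smul, on_zero, smul_zero, sub_zero, ← Module.End.mul_apply, comm.eq,
        Module.End.mul_apply, hb, map_zero]
  | succ j hj₁ ih =>
    have comm : Commute (aeval T f) (S (j + 1)) :=
      commute_aeval_left (hD.tauOp_mul_sigmaOp hs (j + 1) (by omega) (by omega)) f
    exact eq_on_blockIncl_succ h _ hj (S (j + 1)) (LinearMap.congr_fun comm.eq)
      (fun _ => by simp only [LinearMap.zero_apply, map_zero]) (fun b => ih b (by omega)) b

end IsInductionDatum

end InductionDatum

section Presented

variable {R : Type*} [CommRing R] {m : ℕ} (q : Rˣ) (v : Fin m → R) (n : ℕ)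

/-- The coefficient `q - q⁻¹` of the quadratic relations. -/
def qDiff : R := (q : R) - ((q⁻¹ : Rˣ) : R)

/-- The polynomial `(X - v_1) ⋯ (X - v_m)`. -/
noncomputable def cycPoly : R[X] := ∏ a, (X - C (v a))

/-- The generator `τ`, with the junk value `0` if `n = 0`. -/
def genTau : CyclotomicHecke q v n := if hn : 1 ≤ n then tau q v hn else 0

/-- The generator `σ_i`, with the junk value `0` if `i` is out of range. -/
def genSigma (i : ℕ) : CyclotomicHecke q v n :=
  if hi : 1 ≤ i ∧ i < n then sigmaElt q v i hi.1 hi.2 else 0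

theorem monic_cycPoly : (cycPoly v).Monic :=
  monic_prod_of_monic _ _ fun a _ => monic_X_sub_C (v a)

theorem natDegree_cycPoly [Nontrivial R] : (cycPoly v).natDegree = m :=
  (natDegree_finsetProd_X_sub_C_eq_card _ v).trans (Finset.card_fin m)

variable {n}

theorem aeval_cycPoly {H : Type*} [Ring H] [Algebra R H] (t : H) :
    aeval t (cycPoly v) = (List.ofFn fun a : Fin m => t - algebraMap R H (v a)).prod := by
  rw [cycPoly, ← List.prod_ofFn, map_list_prod, List.map_ofFn]
  simp only [Function.comp_def, map_sub, aeval_X, aeval_C]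

theorem genTau_eq (hn : 1 ≤ n) : genTau q v n = tau q v hn := dif_pos hn

theorem genSigma_eq {i : ℕ} (h₁ : 1 ≤ i) (h₂ : i < n) :
    genSigma q v n i = sigmaElt q v i h₁ h₂ := dif_pos ⟨h₁, h₂⟩

theorem aeval_genTau (hn : 1 ≤ n) : aeval (genTau q v n) (cycPoly v) = 0 := by
  rw [genTau_eq q v hn, aeval_cycPoly]
  exact cyclotomic_eq q v hn

variable (n) in
theorem isAffineHeckeFamily_gen :
    IsAffineHeckeFamily (qDiff q) n (genTau q v n) (genSigma q v n) where
  braid i h₁ h₂ := by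
    rw [genSigma_eq q v h₁ (by omega), genSigma_eq q v (by omega) h₂]
    simpa only [map_mul, tau, sigmaElt] using
      RingQuot.mkAlgHom_rel R (Rel.braid (q := q) (v := v) i h₁ h₂)
  comm i j h₁ h₂ h₃ := by
    rw [genSigma_eq q v h₁ (by omega), genSigma_eq q v (by omega) h₃]
    have hij : 1 < |(i : ℤ) - (j : ℤ)| := lt_abs.mpr (Or.inr (by omega))
    simpa only [map_mul, tau, sigmaElt] using
      RingQuot.mkAlgHom_rel R (Rel.comm (q := q) (v := v) i j h₁ (by omega) (by omega) h₃ hij)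
  tau_braid hn := by
    rw [genSigma_eq q v le_rfl hn, genTau_eq q v hn.le]
    simpa only [map_mul, tau, sigmaElt] using
      RingQuot.mkAlgHom_rel R (Rel.tau_braid (q := q) (v := v) hn)
  tau_comm i h₁ h₂ := by
    rw [genSigma_eq q v h₁.le h₂, genTau_eq q v (by omega)]
    simpa only [map_mul, tau, sigmaElt] using
      RingQuot.mkAlgHom_rel R (Rel.tau_comm (q := q) (v := v) i h₁ h₂)
  quadratic i h₁ h₂ := by
    rw [genSigma_eq q v h₁ h₂, ← pow_two]
    exact sigmaElt_sq q v i h₁ h₂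

section Lift

variable {q v} {H : Type*} [Ring H] [Algebra R H] {t : H} {s : ℕ → H}

/-- The algebra map out of `H(m,1,n)` determined by elements satisfying the defining relations. -/
def liftHom (hs : IsAffineHeckeFamily (qDiff q) n t s) (ht : 1 ≤ n → aeval t (cycPoly v) = 0) :
    CyclotomicHecke q v n →ₐ[R] H :=
  RingQuot.liftAlgHom R ⟨FreeAlgebra.lift R fun
    | Gen.tau _ => t
    | Gen.sigma i _ _ => s i, by
    rintro _ _ (⟨i, h₁, h₂⟩ | ⟨i, j, hi₁, hi₂, hj₁, hj₂, hij⟩ | ⟨hn⟩ | ⟨i, h₁, h₂⟩ |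
      ⟨i, h₁, h₂⟩ | ⟨hn⟩)
    · simpa only [map_mul, freeSigma, FreeAlgebra.lift_ι_apply] using hs.braid i h₁ h₂
    · simp only [map_mul, freeSigma, FreeAlgebra.lift_ι_apply]
      rcases lt_abs.mp hij with hij | hij
      · exact (hs.comm j i hj₁ (by omega) hi₂).symm
      · exact hs.comm i j hi₁ (by omega) hj₂
    · simpa only [map_mul, freeSigma, freeTau, FreeAlgebra.lift_ι_apply] using hs.tau_braid hn
    · simpa only [map_mul, freeSigma, freeTau, FreeAlgebra.lift_ι_apply] using
        hs.tau_comm i h₁ h₂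
    · simpa only [map_pow, map_add, map_smul, map_one, freeSigma, FreeAlgebra.lift_ι_apply,
        pow_two, map_mul, qDiff] using hs.quadratic i h₁ h₂
    · rw [map_zero, map_list_prod, List.map_ofFn, ← ht hn, aeval_cycPoly]
      simp only [Function.comp_def, map_sub, AlgHom.commutes, freeTau, FreeAlgebra.lift_ι_apply]⟩

theorem liftHom_genTau (hs : IsAffineHeckeFamily (qDiff q) n t s)
    (ht : 1 ≤ n → aeval t (cycPoly v) = 0) (hn : 1 ≤ n) : liftHom hs ht (genTau q v n) = t := by
  rw [genTau_eq q v hn, tau, liftHom, RingQuot.liftAlgHom_mkAlgHom_apply, freeTau,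
    FreeAlgebra.lift_ι_apply]

theorem liftHom_genSigma (hs : IsAffineHeckeFamily (qDiff q) n t s)
    (ht : 1 ≤ n → aeval t (cycPoly v) = 0) {i : ℕ} (h₁ : 1 ≤ i) (h₂ : i < n) :
    liftHom hs ht (genSigma q v n i) = s i := by
  rw [genSigma_eq q v h₁ h₂, sigmaElt, liftHom, RingQuot.liftAlgHom_mkAlgHom_apply, freeSigma,
    FreeAlgebra.lift_ι_apply]

theorem gen_induction {P : CyclotomicHecke q v n → Prop}
    (algebraMap : ∀ r, P (algebraMap R _ r)) (tau : 1 ≤ n → P (genTau q v n))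
    (sigma : ∀ i, 1 ≤ i → i < n → P (genSigma q v n i))
    (mul : ∀ z z', P z → P z' → P (z * z')) (add : ∀ z z', P z → P z' → P (z + z'))
    (z : CyclotomicHecke q v n) : P z := by
  obtain ⟨z, rfl⟩ := RingQuot.mkAlgHom_surjective R (Rel q v n) z
  induction z using FreeAlgebra.induction with
  | grade0 r => rw [AlgHom.commutes]; exact algebraMap r
  | grade1 g =>
    cases g with
    | tau hn => exact (congrArg P (genTau_eq q v hn)).mp (tau hn)
    | sigma i h₁ h₂ => exact (congrArg P (genSigma_eq q v h₁ h₂)).mp (sigma i h₁ h₂)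
  | mul z z' hz hz' => rw [map_mul]; exact mul _ _ hz hz'
  | add z z' hz hz' => rw [map_add]; exact add _ _ hz hz'

theorem intertwines_of_gen {M N : Type*} [AddCommMonoid M] [Module R M] [AddCommMonoid N]
    [Module R N] (ρ : CyclotomicHecke q v n →ₐ[R] Module.End R M)
    (ρ' : CyclotomicHecke q v n →ₐ[R] Module.End R N) (φ : M →ₗ[R] N)
    (tau : 1 ≤ n → ∀ w, φ (ρ (genTau q v n) w) = ρ' (genTau q v n) (φ w))
    (sigma : ∀ i, 1 ≤ i → i < n → ∀ w,
      φ (ρ (genSigma q v n i) w) = ρ' (genSigma q v n i) (φ w))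
    (z : CyclotomicHecke q v n) : ∀ w, φ (ρ z w) = ρ' z (φ w) := by
  induction z using gen_induction with
  | algebraMap r => intro w; simp only [AlgHom.commutes, Module.algebraMap_end_apply, map_smul]
  | tau hn => exact tau hn
  | sigma i h₁ h₂ => exact sigma i h₁ h₂
  | mul z z' hz hz' => intro w; simp only [map_mul, Module.End.mul_apply, hz, hz']
  | add z z' hz hz' => intro w; simp only [map_add, LinearMap.add_apply, hz, hz']

end Lift

variable (n) in
/-- The algebra map `H(m,1,n) → H(m,1,n+1)` that preserves the generators. -/
def inclHom : CyclotomicHecke q v n →ₐ[R] CyclotomicHecke q v (n + 1) :=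
  liftHom ((isAffineHeckeFamily_gen q v (n + 1)).mono n.le_succ) fun _ =>
    aeval_genTau q v n.succ_pos

theorem inclHom_genTau (hn : 1 ≤ n) : inclHom q v n (genTau q v n) = genTau q v (n + 1) :=
  liftHom_genTau _ _ hn

theorem inclHom_genSigma {i : ℕ} (h₁ : 1 ≤ i) (h₂ : i < n) :
    inclHom q v n (genSigma q v n i) = genSigma q v (n + 1) i :=
  liftHom_genSigma _ _ h₁ h₂

theorem descInv_eq {j : ℕ} (hj : j < n) :
    descInv q v j hj = descInvProd (qDiff q) (genSigma q v n) j := by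
  induction j with
  | zero => rfl
  | succ j ih => rw [descInv, descInvProd, ih, genSigma_eq q v (by omega) hj]; rfl

theorem asc_eq {j : ℕ} (hj : j < n) : asc q v j hj = ascProd (genSigma q v n) j := by
  induction j with
  | zero => rfl
  | succ j ih => rw [asc, ascProd, ih, genSigma_eq q v (by omega) hj]; rfl

theorem factor_eq {k : ℕ} (h₁ : 1 ≤ k) (h₂ : k ≤ n) (j : Fin k) (α : Fin m) :
    factor q v k h₁ h₂ j α = descInvProd (qDiff q) (genSigma q v n) j *
      genTau q v n ^ (α : ℕ) * ascProd (genSigma q v n) (k - 1) := by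
  rw [factor, descInv_eq, asc_eq, genTau_eq]

theorem inclHom_factor {k : ℕ} (h₁ : 1 ≤ k) (h₂ : k ≤ n) (j : Fin k) (α : Fin m) :
    inclHom q v n (factor q v k h₁ h₂ j α) = factor q v k h₁ (by omega) j α := by
  rw [factor_eq, factor_eq, map_mul, map_mul, map_pow, inclHom_genTau q v (by omega),
    map_descInvProd _ _ fun i hi hi' => inclHom_genSigma q v hi (by omega),
    map_ascProd _ fun i hi hi' => inclHom_genSigma q v hi (by omega)]

theorem normalWord_snoc (c : Choice m n) (j : Fin (n + 1)) (α : Fin m) :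
    normalWord q v (Fin.snoc (α := fun i : Fin (n + 1) => Fin (i.val + 1) × Fin m) c (j, α)) =
      descInvProd (qDiff q) (genSigma q v (n + 1)) j * genTau q v (n + 1) ^ (α : ℕ) *
        ascProd (genSigma q v (n + 1)) n * inclHom q v n (normalWord q v c) := by
  rw [normalWord, List.ofFn_succ', List.concat_eq_append, List.reverse_append,
    List.reverse_singleton, List.singleton_append, List.prod_cons]
  congr 1
  · rw [factor_eq, Fin.snoc_last]
    rfl
  · rw [normalWord, map_list_prod, List.map_reverse, List.map_ofFn]
    congr 3
    funext i
    rw [Function.comp, inclHom_factor, Fin.snoc_castSucc]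
    rfl

end Presented

section WordMap

variable {R H B H' : Type*} [CommRing R] [Ring H] [Algebra R H] [Ring B] [Algebra R B] [Ring H']
  [Algebra R H']

/-- The map `μ : B → H'` sends `x ^ k * ι c` to `τ ^ k * σ_1 ⋯ σ_n * incl c`, where `incl` embeds
the algebra `H` of rank `n` into the algebra `H'` of rank `n + 1`, preserving the generators. -/
structure IsWordMap (n : ℕ) (t : H) (s : ℕ → H) (x : B) (ι : H →ₐ[R] B) (t' : H') (s' : ℕ → H')
    (incl : H →ₐ[R] H') (μ : B →ₗ[R] H') : Prop where
  incl_tau : 1 ≤ n → incl t = t'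
  incl_sigma : ∀ i, 1 ≤ i → i < n → incl (s i) = s' i
  coeff : ∀ c, μ (ι c) = ascProd s' n * incl c
  root_mul : ∀ b, μ (x * b) = t' * μ b

/-- The map `⊕_{j ≤ n} B → H'` sending `e_j b` to `σ_j⁻¹ ⋯ σ_1⁻¹ * μ b`. -/
def wordSum (h : R) (n : ℕ) (s' : ℕ → H') (μ : B →ₗ[R] H') : (Fin (n + 1) → B) →ₗ[R] H' :=
  blockSum n fun j => LinearMap.mulLeft R (descInvProd h s' j) ∘ₗ μ

theorem wordSum_blockIncl (h : R) {n j : ℕ} (hj : j ≤ n) (s' : ℕ → H') (μ : B →ₗ[R] H') (b : B) :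
    wordSum h n s' μ (blockIncl R n j b) = descInvProd h s' j * μ b :=
  blockSum_blockIncl hj _ b

namespace IsWordMap

variable {h : R} {n : ℕ} {t : H} {s : ℕ → H} {x : B} {ι : H →ₐ[R] B} {ev : B →ₗ[R] H} {t' : H'}
  {s' : ℕ → H'} {incl : H →ₐ[R] H'} {μ : B →ₗ[R] H'}

theorem apply_sigma_mul (hμ : IsWordMap n t s x ι t' s' incl μ)
    (hD : IsInductionDatum n t x ι ev) (hs : IsAffineHeckeFamily h (n + 1) t' s') {i : ℕ}
    (h₁ : 1 ≤ i) (h₂ : i < n) (b : B) : μ (ι (s i) * b) = s' (i + 1) * μ b := by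
  induction b using hD.induction_on with
  | coeff c =>
    rw [← map_mul, hμ.coeff, hμ.coeff, map_mul, hμ.incl_sigma i h₁ h₂, ← mul_assoc, ← mul_assoc,
      hs.mul_ascProd_of_lt h₁ h₂ n.lt_succ_self]
  | add b b' hb hb' =>
    rw [mul_add, map_add, map_add, hb, hb', mul_add]
  | root_mul b hb =>
    rw [hD.coeff_mul_root_mul, hμ.root_mul, hμ.root_mul, hb, ← mul_assoc, ← mul_assoc,
      hs.tau_comm (i + 1) (by omega) (by omega)]

theorem tau_mul_sigma_mul_apply (hμ : IsWordMap n t s x ι t' s' incl μ)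
    (hD : IsInductionDatum n t x ι ev) (hs : IsAffineHeckeFamily h (n + 1) t' s') (hn : 1 ≤ n)
    (b : B) : t' * (s' 1 * μ b) = (s' 1 - h • 1) * μ (ι t * b) + h • (t' * μ (ι (ev b))) := by
  have hn' : 1 < n + 1 := by omega
  induction b using hD.induction_on with
  | coeff c =>
    simpa only [hD.ev_coeff hn, ← map_mul ι, hμ.coeff, map_mul incl, hμ.incl_tau hn, add_mul,
      smul_mul_assoc, mul_assoc] using
      congrArg (· * incl c) (hs.tau_mul_sigma_mul_ascProd hn n.lt_succ_self)
  | add b b' hb hb' =>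
    simp only [map_add, mul_add, hb, hb', smul_add]
    abel
  | root_mul b hb =>
    have sigma_mul : s' 1 * (t' * (s' 1 * (t' * μ b))) =
        t' * μ (ι t * b) + h • (s' 1 * (t' * μ (ι (t * ev b)))) := calc
      _ = t' * (s' 1 * (t' * (s' 1 * μ b))) := by
        simpa only [mul_assoc] using congrArg (· * μ b) (hs.tau_braid hn').symm
      _ = t' * (s' 1 * ((s' 1 - h • 1) * μ (ι t * b))) +
          h • (t' * s' 1 * t' * ascProd s' n * incl (ev b)) := by
        simp only [hb, mul_add, mul_smul_comm, hμ.coeff, mul_assoc]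
      _ = _ := by
        rw [← mul_assoc (s' 1), hs.mul_inv_eq_one le_rfl hn', one_mul,
          hs.tau_mul_sigma_mul_tau_mul_ascProd hn n.lt_succ_self, hμ.coeff, map_mul incl,
          hμ.incl_tau hn]
        simp only [mul_assoc]
    calc
      t' * (s' 1 * μ (x * b)) = (s' 1 - h • 1) * (s' 1 * (t' * (s' 1 * (t' * μ b)))) := by
        rw [← mul_assoc (s' 1 - h • 1), hs.inv_mul_eq_one le_rfl hn', one_mul, hμ.root_mul]
      _ = (s' 1 - h • 1) * (t' * μ (ι t * b)) +
          h • ((s' 1 - h • 1) * s' 1 * (t' * μ (ι (t * ev b)))) := by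
        rw [sigma_mul, mul_add, mul_smul_comm, mul_assoc _ (s' 1)]
      _ = _ := by
        rw [hs.inv_mul_eq_one le_rfl hn', one_mul, hD.coeff_mul_root_mul, hμ.root_mul,
          hD.ev_root_mul hn]

theorem wordSum_sigmaOp (hμ : IsWordMap n t s x ι t' s' incl μ)
    (hD : IsInductionDatum n t x ι ev) (hs : IsAffineHeckeFamily h (n + 1) t' s') {i : ℕ}
    (h₁ : 1 ≤ i) (h₂ : i < n + 1) (φ : Fin (n + 1) → B) :
    wordSum h n s' μ (sigmaOp h n (fun i => ι (s i)) i φ) = s' i * wordSum h n s' μ φ := by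
  suffices wordSum h n s' μ ∘ₗ sigmaOp h n (fun i => ι (s i)) i =
      LinearMap.mulLeft R (s' i) ∘ₗ wordSum h n s' μ from LinearMap.congr_fun this φ
  obtain ⟨i, rfl⟩ : ∃ k, i = k + 1 := ⟨i - 1, by omega⟩
  have hi : i < n := by omega
  refine linearMap_ext_blockIncl fun j b hj => ?_
  simp only [LinearMap.comp_apply, LinearMap.mulLeft_apply]
  rw [wordSum_blockIncl h hj, ← mul_assoc]
  rcases (show i + 1 < j ∨ j = i + 1 ∨ j = i ∨ j < i by omega) with hij | rfl | rfl | hij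
  · rw [sigmaOp_blockIncl_of_lt h _ hij hj, wordSum_blockIncl h hj,
      hμ.apply_sigma_mul hD hs h₁ (by omega), hs.mul_descInvProd_of_lt h₁ hij (by omega), mul_assoc]
  · rw [sigmaOp_succ_blockIncl_succ h _ hi, wordSum_blockIncl h hi.le, hs.mul_descInvProd_succ h₂]
  · rw [sigmaOp_succ_blockIncl h _ hi, map_add, map_smul, wordSum_blockIncl h hi,
      wordSum_blockIncl h hj, mul_descInvProd, add_mul, smul_mul_assoc]
  · rw [sigmaOp_succ_blockIncl_of_lt h _ hij hi, wordSum_blockIncl h hj,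
      hμ.apply_sigma_mul hD hs (by omega) hi, hs.mul_descInvProd_of_gt (by omega) h₂, mul_assoc]

theorem wordSum_tauOp (hμ : IsWordMap n t s x ι t' s' incl μ) (hD : IsInductionDatum n t x ι ev)
    (ht : IsAffineHeckeFamily h n t s) (hs : IsAffineHeckeFamily h (n + 1) t' s')
    (φ : Fin (n + 1) → B) :
    wordSum h n s' μ (tauOp h n t s x ι ev φ) = t' * wordSum h n s' μ φ := by
  suffices wordSum h n s' μ ∘ₗ tauOp h n t s x ι ev =
      LinearMap.mulLeft R t' ∘ₗ wordSum h n s' μ from LinearMap.congr_fun this φ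
  refine linearMap_ext_blockIncl fun j b hj => ?_
  obtain rfl | hj₁ : j = 0 ∨ 1 ≤ j := by omega
  · simp only [LinearMap.comp_apply, LinearMap.mulLeft_apply, tauOp_blockIncl_zero,
      wordSum_blockIncl h hj, descInvProd, one_mul, hμ.root_mul]
  induction j, hj₁ using Nat.le_induction generalizing b with
  | base =>
    have tau_inv : t' * ((s' 1 - h • 1) * μ b) =
        (s' 1 - h • 1) * μ (ι t * b) + h • (t' * (μ (ι (ev b)) - μ b)) := by
      rw [sub_mul, smul_mul_assoc, one_mul, mul_sub, mul_smul_comm,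
        hμ.tau_mul_sigma_mul_apply hD hs hj, mul_sub, smul_sub, add_sub_assoc]
    simpa only [LinearMap.comp_apply, LinearMap.mulLeft_apply, tauOp_blockIncl_one h t s x ι ev hj,
      map_add, map_smul, wordSum_blockIncl h hj, wordSum_blockIncl h n.zero_le, descInvProd,
      mul_one, one_mul, hμ.root_mul, map_sub, zero_add] using tau_inv.symm
  | succ j hj₁ ih =>
    refine eq_on_blockIncl_succ h (fun i => ι (s i)) hj (LinearMap.mulLeft R (s' (j + 1)))
      (fun φ => ?_) (fun φ => ?_) (fun b => ih b (by omega)) b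
    · have comm := LinearMap.congr_fun (hD.tauOp_mul_sigmaOp ht (j + 1) (by omega) (by omega)) φ
      simp only [Module.End.mul_apply] at comm
      simp only [LinearMap.comp_apply, LinearMap.mulLeft_apply]
      rw [comm, hμ.wordSum_sigmaOp hD hs (by omega) (by omega)]
    · simp only [LinearMap.comp_apply, LinearMap.mulLeft_apply]
      rw [hμ.wordSum_sigmaOp hD hs (by omega) (by omega), ← mul_assoc, ← mul_assoc,
        hs.tau_comm (j + 1) (by omega) (by omega)]

end IsWordMap

end WordMap

section Equiv

variable {R B : Type*} [CommRing R] [Ring B] [Algebra R B] {m : ℕ} {q : Rˣ} {v : Fin m → R}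
  {n : ℕ} {x : B} {ι : CyclotomicHecke q v n →ₐ[R] B} {ev : B →ₗ[R] CyclotomicHecke q v n}
  {μ : B →ₗ[R] CyclotomicHecke q v (n + 1)}

namespace IsInductionDatum

/-- The representation of `H(m,1,n+1)` on `⊕_{j ≤ n} B` by the operators `tauOp` and `sigmaOp`. -/
def rep (hD : IsInductionDatum n (genTau q v n) x ι ev) (hx : aeval x (cycPoly v) = 0) :
    CyclotomicHecke q v (n + 1) →ₐ[R] Module.End R (Fin (n + 1) → B) :=
  liftHom (hD.isAffineHeckeFamily (isAffineHeckeFamily_gen q v n)) fun _ =>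
    hD.aeval_tauOp_eq_zero (isAffineHeckeFamily_gen q v n) hx (aeval_genTau q v)

variable (hD : IsInductionDatum n (genTau q v n) x ι ev) (hx : aeval x (cycPoly v) = 0)

theorem rep_genTau : hD.rep hx (genTau q v (n + 1)) =
    tauOp (qDiff q) n (genTau q v n) (genSigma q v n) x ι ev :=
  liftHom_genTau _ _ n.succ_pos

theorem rep_genSigma {i : ℕ} (h₁ : 1 ≤ i) (h₂ : i < n + 1) :
    hD.rep hx (genSigma q v (n + 1) i) = sigmaOp (qDiff q) n (fun i => ι (genSigma q v n i)) i :=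
  liftHom_genSigma _ _ h₁ h₂

theorem rep_inclHom_apply (z c : CyclotomicHecke q v n) :
    hD.rep hx (inclHom q v n z) (blockIncl R n n (ι c)) = blockIncl R n n (ι (z * c)) := by
  refine (intertwines_of_gen (Algebra.lmul R _) ((hD.rep hx).comp (inclHom q v n))
    (blockIncl R n n ∘ₗ ι.toLinearMap) (fun hn c => ?_) (fun i h₁ h₂ c => ?_) z c).symm
  · obtain ⟨k, rfl⟩ : ∃ k, n = k + 1 := ⟨n - 1, by omega⟩
    simp only [LinearMap.comp_apply, AlgHom.comp_apply, AlgHom.toLinearMap_apply,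
      Algebra.coe_lmul_eq_mul, LinearMap.mul_apply', inclHom_genTau q v hn, hD.rep_genTau hx,
      tauOp_blockIncl_succ _ _ _ _ ι ev (show k < k + 1 by omega), hD.ev_coeff hn, sub_self,
      mul_zero, map_zero, smul_zero, add_zero, map_mul]
  · simp only [LinearMap.comp_apply, AlgHom.comp_apply, AlgHom.toLinearMap_apply,
      Algebra.coe_lmul_eq_mul, LinearMap.mul_apply', inclHom_genSigma q v h₁ h₂,
      hD.rep_genSigma hx h₁ (h₂.trans n.lt_succ_self), sigmaOp_blockIncl_of_lt _ _ h₂ le_rfl,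
      map_mul]

theorem rep_descInvProd_apply {j : ℕ} (hj : j ≤ n) (b : B) :
    hD.rep hx (descInvProd (qDiff q) (genSigma q v (n + 1)) j) (blockIncl R n 0 b) =
      blockIncl R n j b := by
  induction j with
  | zero => rw [descInvProd, map_one, Module.End.one_apply]
  | succ j ih =>
    rw [descInvProd, map_mul, Module.End.mul_apply, ih (by omega), map_sub, map_smul, map_one,
      hD.rep_genSigma hx (by omega) (by omega), ← blockIncl_succ _ _ hj]

theorem rep_ascProd_apply {j : ℕ} (hj : j ≤ n) (b : B) :
    hD.rep hx (ascProd (genSigma q v (n + 1)) j) (blockIncl R n j b) = blockIncl R n 0 b := by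
  induction j with
  | zero => rw [ascProd, map_one, Module.End.one_apply]
  | succ j ih =>
    rw [ascProd, map_mul, Module.End.mul_apply, hD.rep_genSigma hx (by omega) (by omega),
      sigmaOp_succ_blockIncl_succ _ _ hj, ih (by omega)]

end IsInductionDatum

namespace IsWordMap

variable (hμ : IsWordMap n (genTau q v n) (genSigma q v n) x ι (genTau q v (n + 1))
    (genSigma q v (n + 1)) (inclHom q v n) μ)
  (hD : IsInductionDatum n (genTau q v n) x ι ev) (hx : aeval x (cycPoly v) = 0)
include hμ

theorem wordSum_rep (z : CyclotomicHecke q v (n + 1)) (φ : Fin (n + 1) → B) :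
    wordSum (qDiff q) n (genSigma q v (n + 1)) μ (hD.rep hx z φ) =
      z * wordSum (qDiff q) n (genSigma q v (n + 1)) μ φ := by
  have gen := isAffineHeckeFamily_gen q v (n + 1)
  refine intertwines_of_gen (hD.rep hx) (Algebra.lmul R _) _ (fun _ φ => ?_)
    (fun i h₁ h₂ φ => ?_) z φ
  · rw [hD.rep_genTau, hμ.wordSum_tauOp hD (isAffineHeckeFamily_gen q v n) gen]
    rfl
  · rw [hD.rep_genSigma hx h₁ h₂, hμ.wordSum_sigmaOp hD gen h₁ h₂]
    rfl

theorem rep_apply_top (b : B) :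
    hD.rep hx (μ b) (blockIncl R n n 1) = blockIncl R n 0 b := by
  induction b using hD.induction_on with
  | coeff c =>
    rw [← map_one ι, hμ.coeff, map_mul, Module.End.mul_apply, hD.rep_inclHom_apply, mul_one,
      hD.rep_ascProd_apply hx le_rfl]
  | add b b' hb hb' =>
    rw [map_add, map_add, LinearMap.add_apply, hb, hb', map_add]
  | root_mul b hb =>
    rw [hμ.root_mul, map_mul, Module.End.mul_apply, hb, hD.rep_genTau, tauOp_blockIncl_zero]

/-- The isomorphism `⊕_{j ≤ n} B ≃ H(m,1,n+1)` given by `wordSum`; its inverse lets the algebra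
act on `e_n 1`, whose image is `σ_n⁻¹ ⋯ σ_1⁻¹ σ_1 ⋯ σ_n = 1`. -/
def inductionEquiv : (Fin (n + 1) → B) ≃ₗ[R] CyclotomicHecke q v (n + 1) :=
  LinearEquiv.ofLinearMap (wordSum (qDiff q) n (genSigma q v (n + 1)) μ)
    (LinearMap.applyₗ (blockIncl R n n 1) ∘ₗ (hD.rep hx).toLinearMap)
    (LinearMap.ext fun z => by
      rw [LinearMap.comp_apply, LinearMap.comp_apply, LinearMap.applyₗ_apply_apply,
        AlgHom.toLinearMap_apply, hμ.wordSum_rep hD hx, wordSum_blockIncl _ le_rfl, ← map_one ι,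
        hμ.coeff, map_one, mul_one,
        (isAffineHeckeFamily_gen q v (n + 1)).descInvProd_mul_ascProd n.lt_succ_self, mul_one,
        LinearMap.id_apply])
    (linearMap_ext_blockIncl fun j b hj => by
      rw [LinearMap.comp_apply, LinearMap.comp_apply, LinearMap.applyₗ_apply_apply,
        AlgHom.toLinearMap_apply, wordSum_blockIncl _ hj, map_mul, Module.End.mul_apply,
        hμ.rep_apply_top hD hx, hD.rep_descInvProd_apply hx hj, LinearMap.id_apply])

theorem inductionEquiv_blockIncl {j : ℕ} (hj : j ≤ n) (b : B) :
    hμ.inductionEquiv hD hx (blockIncl R n j b) =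
      descInvProd (qDiff q) (genSigma q v (n + 1)) j * μ b :=
  wordSum_blockIncl _ hj _ _ b

end IsWordMap

end Equiv

section CoefficientAlgebra

variable {R H N : Type*} [CommRing R] [Semiring H] [Algebra R H] [Semiring N] [Algebra R N]
  {f : R[X]}

/-- The algebra map `R[X]/(f) → N` given by evaluation at a root `t` of `f` in the possibly
noncommutative algebra `N`. -/
noncomputable def rootHom {t : N} (ht : aeval t f = 0) : AdjoinRoot f →ₐ[R] N :=
  Ideal.Quotient.liftₐ (Ideal.span {f}) (aeval t) fun a ha => by
    obtain ⟨b, rfl⟩ := Ideal.mem_span_singleton'.mp ha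
    rw [map_mul, ht, mul_zero]

theorem rootHom_root {t : N} (ht : aeval t f = 0) : rootHom ht (AdjoinRoot.root f) = t :=
  aeval_X t

/-- The linear map `R[X]/(f) ⊗ H → N` with `p ⊗ c ↦ p(t) * ψ c`, for a root `t` of `f`. -/
noncomputable def tensorEval {t : N} (ht : aeval t f = 0) (ψ : H →ₗ[R] N) :
    AdjoinRoot f ⊗[R] H →ₗ[R] N :=
  TensorProduct.lift ((LinearMap.mul R N).compl₁₂ (rootHom ht).toLinearMap ψ)

theorem tensorEval_tmul {t : N} (ht : aeval t f = 0) (ψ : H →ₗ[R] N) (p : AdjoinRoot f) (c : H) :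
    tensorEval ht ψ (p ⊗ₜ c) = rootHom ht p * ψ c := rfl

theorem tensorEval_one_tmul {t : N} (ht : aeval t f = 0) (ψ : H →ₗ[R] N) (c : H) :
    tensorEval ht ψ (1 ⊗ₜ c) = ψ c := by
  rw [tensorEval_tmul, map_one, one_mul]

theorem tensorEval_root_mul {t : N} (ht : aeval t f = 0) (ψ : H →ₗ[R] N)
    (b : AdjoinRoot f ⊗[R] H) :
    tensorEval ht ψ ((AdjoinRoot.root f ⊗ₜ 1) * b) = t * tensorEval ht ψ b := by
  induction b using TensorProduct.induction_on with
  | zero => simp only [mul_zero, map_zero]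
  | tmul p c =>
    rw [Algebra.TensorProduct.tmul_mul_tmul, one_mul, tensorEval_tmul, tensorEval_tmul, map_mul,
      rootHom_root, mul_assoc]
  | add b b' hb hb' => rw [mul_add, map_add, map_add, hb, hb', mul_add]

theorem aeval_root_tmul_one : aeval (AdjoinRoot.root f ⊗ₜ[R] (1 : H)) f = 0 := by
  change aeval (Algebra.TensorProduct.includeLeft (S := R) (AdjoinRoot.root f)) f = 0
  rw [aeval_algHom_apply, AdjoinRoot.aeval_eq, AdjoinRoot.mk_self, map_zero]

theorem root_tensor_induction {P : AdjoinRoot f ⊗[R] H → Prop} (one_tmul : ∀ c, P (1 ⊗ₜ c))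
    (add : ∀ b b', P b → P b' → P (b + b'))
    (root_mul : ∀ b, P b → P ((AdjoinRoot.root f ⊗ₜ 1) * b)) (b : AdjoinRoot f ⊗[R] H) : P b := by
  induction b using TensorProduct.induction_on with
  | zero => exact (congrArg P (TensorProduct.tmul_zero H (1 : AdjoinRoot f))).mp (one_tmul 0)
  | add b b' hb hb' => exact add b b' hb hb'
  | tmul p c =>
    obtain ⟨p, rfl⟩ := AdjoinRoot.mk_surjective p
    induction p using Polynomial.induction_on with
    | C r =>
      have C_tmul : AdjoinRoot.mk f (C r) ⊗ₜ[R] c = 1 ⊗ₜ (r • c) := by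
        rw [TensorProduct.tmul_smul, TensorProduct.smul_tmul', Algebra.smul_def, mul_one]
        rfl
      exact C_tmul ▸ one_tmul _
    | add p p' hp hp' =>
      rw [map_add, TensorProduct.add_tmul]
      exact add _ _ hp hp'
    | monomial k r ih =>
      have root_mul_tmul : AdjoinRoot.mk f (C r * X ^ (k + 1)) ⊗ₜ[R] c =
          (AdjoinRoot.root f ⊗ₜ 1) * (AdjoinRoot.mk f (C r * X ^ k) ⊗ₜ c) := by
        rw [Algebra.TensorProduct.tmul_mul_tmul, one_mul, pow_succ, ← mul_assoc, map_mul, mul_comm,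
          AdjoinRoot.mk_X]
      exact root_mul_tmul ▸ root_mul _ ih

end CoefficientAlgebra

section NormalBasis

variable {R : Type*} [CommRing R] {m : ℕ} (q : Rˣ) (v : Fin m → R) (n : ℕ)

/-- The evaluation `R[X]/(f) ⊗ H(m,1,n) → H(m,1,n)` at `X = τ`, with the junk value `0` if `n = 0`,
where there is no `τ`. -/
noncomputable def tauEval :
    AdjoinRoot (cycPoly v) ⊗[R] CyclotomicHecke q v n →ₗ[R] CyclotomicHecke q v n :=
  if hn : 1 ≤ n then tensorEval (aeval_genTau q v hn) LinearMap.id else 0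

theorem tauEval_eq {n : ℕ} (hn : 1 ≤ n) :
    tauEval q v n = tensorEval (aeval_genTau q v hn) LinearMap.id := dif_pos hn

theorem isInductionDatum_tauEval :
    IsInductionDatum n (genTau q v n) (AdjoinRoot.root (cycPoly v) ⊗ₜ 1)
      Algebra.TensorProduct.includeRight (tauEval q v n) where
  commute c := by
    rw [Commute, SemiconjBy, Algebra.TensorProduct.includeRight_apply,
      Algebra.TensorProduct.tmul_mul_tmul, Algebra.TensorProduct.tmul_mul_tmul, one_mul, one_mul,
      mul_one, mul_one]
  eq_top _ coeff root_mul := eq_top_iff.mpr fun b _ =>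
    root_tensor_induction coeff (fun _ _ => add_mem) root_mul b
  ev_root_mul hn b := by rw [tauEval_eq q v hn, tensorEval_root_mul]
  ev_coeff hn c := by
    rw [tauEval_eq q v hn, Algebra.TensorProduct.includeRight_apply, tensorEval_one_tmul,
      LinearMap.id_apply]

/-- The map `p ⊗ c ↦ p(τ) σ_1 ⋯ σ_n c` from `R[X]/(f) ⊗ H(m,1,n)` to `H(m,1,n+1)`. -/
noncomputable def wordMap :
    AdjoinRoot (cycPoly v) ⊗[R] CyclotomicHecke q v n →ₗ[R] CyclotomicHecke q v (n + 1) :=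
  tensorEval (aeval_genTau q v n.succ_pos)
    (LinearMap.mulLeft R (ascProd (genSigma q v (n + 1)) n) ∘ₗ (inclHom q v n).toLinearMap)

theorem isWordMap_wordMap :
    IsWordMap n (genTau q v n) (genSigma q v n) (AdjoinRoot.root (cycPoly v) ⊗ₜ 1)
      Algebra.TensorProduct.includeRight (genTau q v (n + 1)) (genSigma q v (n + 1))
      (inclHom q v n) (wordMap q v n) where
  incl_tau := inclHom_genTau q v
  incl_sigma _ := inclHom_genSigma q v
  coeff := tensorEval_one_tmul _ _
  root_mul := tensorEval_root_mul _ _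

theorem wordMap_root_pow_tmul (k : ℕ) (c : CyclotomicHecke q v n) :
    wordMap q v n ((AdjoinRoot.root (cycPoly v) ^ k) ⊗ₜ c) =
      genTau q v (n + 1) ^ k * (ascProd (genSigma q v (n + 1)) n * inclHom q v n c) := by
  rw [wordMap, tensorEval_tmul, map_pow, rootHom_root]
  rfl

theorem bijective_algebraMap_zero :
    Function.Bijective (algebraMap R (CyclotomicHecke q v 0)) := by
  have family : IsAffineHeckeFamily (qDiff q) 0 (0 : R) fun _ => 0 :=
    ⟨⟨by omega, by omega, by omega⟩, by omega, by omega⟩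
  refine ⟨Function.LeftInverse.injective (g := liftHom (v := v) family (by omega)) fun r =>
    AlgHom.commutes _ r, fun z => ?_⟩
  rw [← RingHom.mem_range]
  induction z using gen_induction with
  | algebraMap r => exact ⟨r, rfl⟩
  | tau hn => omega
  | sigma i h₁ h₂ => omega
  | mul z z' hz hz' => exact mul_mem hz hz'
  | add z z' hz hz' => exact add_mem hz hz'

theorem exists_basis_zero : ∃ b : Module.Basis (Choice m 0) R (CyclotomicHecke q v 0),
    ⇑b = normalWord q v := by
  refine ⟨(Module.Basis.singleton (Choice m 0) R).map
    (LinearEquiv.ofBijective (Algebra.linearMap R _) (bijective_algebraMap_zero q v)), ?_⟩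
  funext c
  rw [Module.Basis.map_apply, Module.Basis.singleton_apply]
  exact map_one (algebraMap R _)

theorem exists_basis_pow_root : ∃ b : Module.Basis (Fin m) R (AdjoinRoot (cycPoly v)),
    ∀ α, b α = AdjoinRoot.root (cycPoly v) ^ α.val := by
  cases subsingleton_or_nontrivial R with
  | inl _ =>
    have := Module.subsingleton R (AdjoinRoot (cycPoly v))
    exact ⟨.ofRepr 0, fun _ => Subsingleton.elim _ _⟩
  | inr _ =>
    refine ⟨(AdjoinRoot.powerBasis' (monic_cycPoly v)).basis.reindex
      (finCongr (natDegree_cycPoly v)), fun α => ?_⟩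
    rw [Module.Basis.reindex_apply, PowerBasis.basis_eq_pow]
    rfl

/-- The splitting of a choice for `n + 1` factors into the pair `(j, α)` of the leftmost factor
`u_{n+1}` and a choice for the others. -/
def choiceSuccEquiv (m n : ℕ) : (Σ _ : Fin (n + 1), Fin m × Choice m n) ≃ Choice m (n + 1) :=
  ((Equiv.sigmaEquivProd _ _).trans (Equiv.prodAssoc _ _ _).symm).trans
    (Fin.snocEquiv fun i : Fin (n + 1) => Fin (i.val + 1) × Fin m)

theorem exists_basis_succ
    (hn : ∃ b : Module.Basis (Choice m n) R (CyclotomicHecke q v n), ⇑b = normalWord q v) :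
    ∃ b : Module.Basis (Choice m (n + 1)) R (CyclotomicHecke q v (n + 1)),
      ⇑b = normalWord q v := by
  obtain ⟨b, hb⟩ := hn
  obtain ⟨bA, hbA⟩ := exists_basis_pow_root v
  let bM : Module.Basis (Σ _ : Fin (n + 1), Fin m × Choice m n) R
      (Fin (n + 1) → AdjoinRoot (cycPoly v) ⊗[R] CyclotomicHecke q v n) :=
    Pi.basis fun _ => bA.tensorProduct b
  let e := (isWordMap_wordMap q v n).inductionEquiv (isInductionDatum_tauEval q v n)
    aeval_root_tmul_one
  refine ⟨(bM.map e).reindex (choiceSuccEquiv m n), ?_⟩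
  funext c
  obtain ⟨⟨j, α, c⟩, rfl⟩ := (choiceSuccEquiv m n).surjective c
  have hbM : bM ⟨j, α, c⟩ = blockIncl R n j
      ((AdjoinRoot.root (cycPoly v) ^ α.val) ⊗ₜ normalWord q v c) := by
    rw [Pi.basis_apply, Module.Basis.tensorProduct_apply, hbA, hb, blockIncl_val]
    rfl
  rw [Module.Basis.reindex_apply, Equiv.symm_apply_apply, Module.Basis.map_apply, hbM,
    IsWordMap.inductionEquiv_blockIncl _ _ _ (Nat.le_of_lt_succ j.isLt), wordMap_root_pow_tmul,
    ← mul_assoc, ← mul_assoc]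
  exact (normalWord_snoc q v c j α).symm

theorem exists_basis :
    ∃ b : Module.Basis (Choice m n) R (CyclotomicHecke q v n), ⇑b = normalWord q v := by
  induction n with
  | zero => exact exists_basis_zero q v
  | succ n ih => exact exists_basis_succ q v n ih

end NormalBasis

end CyclotomicHecke

theorem mainTheorem10 {R : Type*} [CommRing R] (m n : ℕ) (q : Rˣ) (v : Fin m → R)
    (x : CyclotomicHecke q v n) :
    ∃! a : CyclotomicHecke.Choice m n → R,
      x = ∑ c : CyclotomicHecke.Choice m n, a c • CyclotomicHecke.normalWord q v c := by
  obtain ⟨b, hb⟩ := CyclotomicHecke.exists_basis q v n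
  simpa only [Module.Basis.equivFun_symm_apply, hb, LinearEquiv.coe_coe, eq_comm (a := x)] using
    b.equivFun.symm.bijective.existsUnique x
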